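/- Let $q=p^{\alpha}$, where $p\equiv 1\pmod 8$ is a prime and $\alpha\ge 1$ is an integer. Let $g$ be a generator of the cyclic group $\mathbb{Z}_q^{\ast}$ of units of $\mathbb{Z}_q=\mathbb{Z}/q\mathbb{Z}$, and let $G^{\ast}(q)$ be the Peisert-like graph: its vertex set is $\mathbb{Z}_q$, and $x,y$ are adjacent if and only if $x-y\in\langle g^4\rangle\cup g\langle g^4\rangle$. Let $k_4(G^{\ast}(q))$ be the number of cliques of order $4$ (sets of four pairwise adjacent vertices) in $G^{\ast}(q)$. For Dirichlet characters $A,B$ mod $q$ let $J(A,B)=\sum_{x\in\mathbb{Z}_q}A(x)B(1-x)$ be the Jacobi sum and put $\binom{A}{B}=\frac{B(-1)}{q}J(A,\overline{B})$. For Dirichlet characters $A_0,\dots,A_n,B_1,\dots,B_n$ mod $q$ and $x\in\mathbb{Z}_q$ define $$ {}_{n+1}F_n\left(\begin{matrix}A_0,&A_1,&\dots,&A_n\\&B_1,&\dots,&B_n\end{matrix}\,\Big|\,x\right)=\frac{q}{\phi(q)}\sum_{\chi}\binom{A_0\chi}{\chi}\binom{A_1\chi}{B_1\chi}\cdots\binom{A_n\chi}{B_n\chi}\chi(x),$$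 where $\chi$ runs over all Dirichlet characters mod $q$ and $\phi$ is Euler's totient function. Let $\chi_4$ be a Dirichlet character mod $q$ of order $4$, and let $\varphi$ and $\varepsilon$ be the quadratic character (the character of order $2$) and the trivial character mod $q$. Let $\rho=J(\chi_4,\chi_4)$, $\xi=J(\chi_4,\varphi)$, $$M_3=q^2\cdot{}_3F_2\left(\begin{matrix}\chi_4,&\overline{\chi_4},&\overline{\chi_4}\\&\varphi,&\varepsilon\end{matrix}\,\Big|\,1\right),\qquad M_5=q^2\cdot{}_3F_2\left(\begin{matrix}\chi_4,&\chi_4,&\overline{\chi_4}\\&\varepsilon,&\varepsilon\end{matrix}\,\Big|\,1\right).$$ Then $$k_4(G^{\ast}(q))=\frac{p^{2\alpha-1}(p-1)}{3072}\Big[2p^{2\alpha-2}(p^2-20p+81)+2\,\mathrm{Im}(\rho)^2+4\,\mathrm{Im}(\rho)\,\mathrm{Im}(\xi)-\mathrm{Re}(M_3)+3M_5\Big].$$ -/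

import Mathlib

noncomputable section

/-- The subset `⟨g⁴⟩ ∪ g⟨g⁴⟩` of `ℤ/n`, for a unit `g` of `ℤ/n`. -/
def peisertConnectionSet {n : ℕ} (g : (ZMod n)ˣ) : Set (ZMod n) :=
  {x | ∃ u ∈ Subgroup.zpowers (g ^ 4), x = (u : ZMod n) ∨ x = (g : ZMod n) * (u : ZMod n)}

/-- The Peisert-like graph on the vertex set `ℤ/n` attached to a unit `g` (meant to be a generator
of the unit group): `x` and `y` are adjacent iff `x - y ∈ ⟨g⁴⟩ ∪ g⟨g⁴⟩`. The symmetrization and the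
exclusion of loops that are built into `SimpleGraph.circulantGraph` have no effect for the moduli
of interest, see `peisertLikeGraph_adj`. -/
def peisertLikeGraph {n : ℕ} (g : (ZMod n)ˣ) : SimpleGraph (ZMod n) :=
  SimpleGraph.circulantGraph (peisertConnectionSet g)

/-- For `n = p ^ α` with `p ≡ 1 (mod 8)` and `g` a generator of the unit group, adjacency in the
Peisert-like graph is exactly `x - y ∈ ⟨g⁴⟩ ∪ g⟨g⁴⟩`. -/
theorem peisertLikeGraph_adj {p α : ℕ} [Fact p.Prime] (hp : p % 8 = 1) (hα : 1 ≤ α)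
    (g : (ZMod (p ^ α))ˣ) (hg : ∀ u : (ZMod (p ^ α))ˣ, u ∈ Subgroup.zpowers g)
    (x y : ZMod (p ^ α)) :
    (peisertLikeGraph g).Adj x y ↔ x - y ∈ peisertConnectionSet g := by
  have hprime : p.Prime := Fact.out
  have hneg : (-1 : (ZMod (p ^ α))ˣ) ∈ Subgroup.zpowers (g ^ 4) := by
    obtain ⟨k, hk⟩ := Subgroup.mem_zpowers_iff.1 (hg (-1))
    have hcard : orderOf g = Nat.totient (p ^ α) := by
      rw [orderOf_eq_card_of_forall_mem_zpowers hg, Nat.card_eq_fintype_card,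
        ZMod.card_units_eq_totient]
    have h8 : 8 ∣ orderOf g := by
      rw [hcard, Nat.totient_prime_pow hprime hα]
      exact Dvd.dvd.mul_left (by omega) _
    have h1 : g ^ (k * 2) = 1 := by
      rw [zpow_mul, hk]
      simp
    have h2 : (orderOf g : ℤ) ∣ k * 2 := orderOf_dvd_iff_zpow_eq_one.2 h1
    have h3 : (8 : ℤ) ∣ k * 2 := dvd_trans (by exact_mod_cast h8) h2
    obtain ⟨m, rfl⟩ : (4 : ℤ) ∣ k := by omega
    refine Subgroup.mem_zpowers_iff.2 ⟨m, ?_⟩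
    rw [← hk, zpow_mul]
    norm_cast
  have hsymm : ∀ z : ZMod (p ^ α), z ∈ peisertConnectionSet g → -z ∈ peisertConnectionSet g := by
    rintro z ⟨u, hu, h⟩
    refine ⟨-1 * u, Subgroup.mul_mem _ hneg hu, ?_⟩
    rcases h with rfl | rfl <;> simp
  have hq : 1 < p ^ α := Nat.one_lt_pow (by omega) hprime.one_lt
  have : Fact (1 < p ^ α) := ⟨hq⟩
  have hzero : (0 : ZMod (p ^ α)) ∉ peisertConnectionSet g := by
    rintro ⟨u, -, h | h⟩
    · exact u.ne_zero h.symm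
    · exact (g * u).ne_zero (by rw [Units.val_mul]; exact h.symm)
  rw [peisertLikeGraph, SimpleGraph.circulantGraph_adj]
  constructor
  · rintro ⟨-, h | h⟩
    · exact h
    · simpa using hsymm _ h
  · intro h
    refine ⟨?_, Or.inl h⟩
    rintro rfl
    exact hzero (by simpa using h)

/-- The binomial coefficient of two Dirichlet characters mod `q`: `(B(-1)/q) J(A, B̄)`, where
`J(A, B) = ∑ x : ℤ/q, A(x) B(1 - x)` is `jacobiSum A B`, and the complex conjugate character of `B`
is its inverse `B⁻¹` (`MulChar.star_eq_inv`). -/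
def dirichletBinom {q : ℕ} [NeZero q] (A B : DirichletCharacter ℂ q) : ℂ :=
  B (-1) / (q : ℂ) * jacobiSum A B⁻¹

/-- The hypergeometric function `_{n+1}F_n` of Dirichlet characters `A₀, A₁, …, Aₙ` and
`B₁, …, Bₙ` mod `q`, evaluated at `x : ℤ/q`; the sum is over all Dirichlet characters mod `q`. -/
def dirichletHypergeometric {q : ℕ} [NeZero q] {n : ℕ} (A₀ : DirichletCharacter ℂ q)
    (A B : Fin n → DirichletCharacter ℂ q) (x : ZMod q) : ℂ :=
  (q : ℂ) / (Nat.totient q : ℂ) *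
    ∑ χ : DirichletCharacter ℂ q,
      dirichletBinom (A₀ * χ) χ * (∏ i : Fin n, dirichletBinom (A i * χ) (B i * χ)) * χ x

end

/-!
The quartic character `χ₄` has order prime to `p`, so it comes from a character `χ` of `ℤ/p`, and
the adjacency relation and all the character sums factor through the reduction modulo `p`: up to
powers of `p`, the problem is to count the ordered `4`-cliques over the field `ℤ/p`. Let `c` be the
sign function, a combination of `χ` and `χ⁻¹`, that is `1` on `⟨g⁴⟩ ∪ g⟨g⁴⟩` and `-1` on the other
units. The count is the sum, over all injective quadruples, of the product of `(1 + c) / 2` along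
the edges of `K₄`.

Expand this product over the subgraphs of `K₄`. Multiplication by `g²` changes the sign of `c`,
which removes the subgraphs with an odd number of edges. As `c` sums to zero, pendant edges can be
summed out, and the `4`-cycles are evaluated by the convolution identity
`∑ c(a - x) c(x - b) = ± Im J(χ, χ) χ²(a - b) - 1`. There remains `K₄` itself: its sum is invariant
under affine maps, so that two of the four points can be put at `0` and `1`, and the resulting
double sums of products of values of `χ` and `χ⁻¹` are, up to powers of `p`, the values `M₃`, its
conjugate, and `M₅`. Finally `χ(4) = 1` and the duplication formula for Jacobi sums give `ρ = ξ`.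
-/

section Cliques

variable {V : Type*}

theorem card_copy_top [Finite V] (G : SimpleGraph V) (n : ℕ) :
    Nat.card ((⊤ : SimpleGraph (Fin n)).Copy G) = n.factorial * (G.cliqueSet n).ncard := by
  classical
  let ofEnum (e : Σ s : G.cliqueSet n, Fin n ≃ (s : Finset V)) :
      (⊤ : SimpleGraph (Fin n)).Copy G :=
    ⟨⟨fun i => e.2 i, fun {i j} hij => e.1.2.1 (e.2 i).2 (e.2 j).2
      fun h => hij (e.2.injective (Subtype.ext h))⟩,
      fun i j h => e.2.injective (Subtype.ext h)⟩
  have bijective_ofEnum : Function.Bijective ofEnum := by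
    constructor
    · rintro ⟨⟨s, hs⟩, e⟩ ⟨⟨t, ht⟩, e'⟩ h
      have hval : ∀ i, (e i : V) = e' i := fun i => DFunLike.congr_fun h i
      obtain rfl : s = t := by
        ext x
        exact ⟨fun hx => by simpa [← hval] using (e' (e.symm ⟨x, hx⟩)).2,
          fun hx => by simpa [hval] using (e (e'.symm ⟨x, hx⟩)).2⟩
      obtain rfl : e = e' := Equiv.ext fun i => Subtype.ext (hval i)
      rfl
    · intro f
      have hs : Finset.univ.map f.toEmbedding ∈ G.cliqueSet n := by
        simpa using SimpleGraph.isNClique_map_copy_top f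
      exact ⟨⟨⟨_, hs⟩, .ofBijective
        (fun i => ⟨f i, Finset.mem_map_of_mem f.toEmbedding (Finset.mem_univ i)⟩)
        ⟨fun i j h => f.injective (congrArg Subtype.val h), fun ⟨x, hx⟩ => by
          obtain ⟨i, -, rfl⟩ := Finset.mem_map.1 hx
          exact ⟨i, rfl⟩⟩⟩, SimpleGraph.Copy.ext fun i => rfl⟩
  have card_enum (s : G.cliqueSet n) : Nat.card (Fin n ≃ (s : Finset V)) = n.factorial := by
    rw [Nat.card_eq_fintype_card, Fintype.card_equiv (Finset.equivFinOfCardEq s.2.2).symm,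
      Fintype.card_fin]
  have := Fintype.ofFinite V
  rw [← Nat.card_congr (Equiv.ofBijective ofEnum bijective_ofEnum), Nat.card_sigma]
  simp only [card_enum, Finset.sum_const, smul_eq_mul, Finset.card_univ, mul_comm,
    ← Nat.card_eq_fintype_card, Nat.card_coe_set_eq]

theorem card_copy_top_eq_sum [Fintype V] (K : Type*) [CommSemiring K] (G : SimpleGraph V)
    [DecidableRel G.Adj] (n : ℕ) :
    (Nat.card ((⊤ : SimpleGraph (Fin n)).Copy G) : K) =
      ∑ v : Fin n → V, ∏ i, ∏ j ∈ Finset.Ioi i, if G.Adj (v i) (v j) then 1 else 0 := by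
  classical
  let e : (⊤ : SimpleGraph (Fin n)).Copy G ≃
      {v : Fin n → V // ∀ i, ∀ j ∈ Finset.Ioi i, G.Adj (v i) (v j)} :=
    { toFun := fun f => ⟨f, fun i j hij => f.toHom.map_adj (Finset.mem_Ioi.1 hij).ne⟩
      invFun := fun v =>
        have hadj : ∀ {i j}, i ≠ j → G.Adj (v.1 i) (v.1 j) := fun {i j} hij =>
          hij.lt_or_gt.elim (fun h => v.2 i j (Finset.mem_Ioi.2 h))
            fun h => (v.2 j i (Finset.mem_Ioi.2 h)).symm
        ⟨⟨v.1, hadj⟩, fun i j h => by_contra fun hij => (hadj hij).ne h⟩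
      left_inv := fun f => rfl
      right_inv := fun v => rfl }
  rw [Nat.card_congr e, Nat.card_eq_fintype_card, Fintype.card_subtype,
    Finset.natCast_card_filter]
  refine Finset.sum_congr rfl fun v _ => ?_
  simp [Finset.prod_ite_zero]

end Cliques

section Embeddings

variable {X K : Type*} [Fintype X]

theorem sum_embedding_comp [AddCommMonoid K] {ι : Type*} [Fintype ι] {σ : ι → ι}
    (hσ : Function.Injective σ) (f : (ι → X) → K) : ∑ v : ι ↪ X, f (v ∘ σ) = ∑ v : ι ↪ X, f v :=
  let e := Equiv.ofBijective σ (Finite.injective_iff_bijective.1 hσ)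
  Fintype.sum_equiv (e.symm.embeddingCongr (Equiv.refl X)) _ _ fun _ => rfl

theorem sum_comp_of_injective [AddCommMonoid K] {ι : Type*} [Fintype ι] [DecidableEq ι]
    {σ : ι → ι} (hσ : Function.Injective σ) (f : (ι → X) → K) :
    ∑ v : ι → X, f (v ∘ σ) = ∑ v, f v :=
  let e := Equiv.ofBijective σ (Finite.injective_iff_bijective.1 hσ)
  Fintype.sum_equiv (e.symm.arrowCongr (Equiv.refl X)) _ _ fun _ => rfl

theorem sum_embedding_succ [AddCommGroup K] {n : ℕ} (f : (Fin (n + 1) → X) → K) :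
    ∑ v : Fin (n + 1) ↪ X, f v =
      ∑ u : Fin n ↪ X, (∑ y, f (Fin.cons y u) - ∑ i, f (Fin.cons (u i) u)) := by
  classical
  rw [← (Equiv.embeddingFinSucc n X).symm.sum_comp fun v => f v, Fintype.sum_sigma]
  refine Finset.sum_congr rfl fun u _ => ?_
  simp only [Equiv.coe_embeddingFinSucc_symm]
  rw [eq_sub_iff_add_eq, ← Finset.sum_map _ u fun y => f (Fin.cons y u),
    ← Finset.sum_subtype (Finset.univ.map u)ᶜ (by simp) fun y => f (Fin.cons y u),
    Finset.sum_compl_add_sum]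

end Embeddings

section EmbeddingsRing

variable {X K : Type*} [Fintype X] [CommRing K] {n : ℕ}

theorem sum_embedding_comp_succ (f : (Fin n → X) → K) :
    ∑ v : Fin (n + 1) ↪ X, f (v ∘ Fin.succ) = (Fintype.card X - n) * ∑ u : Fin n ↪ X, f u := by
  rw [sum_embedding_succ fun v => f (v ∘ Fin.succ), Finset.mul_sum]
  simp [Function.comp_def, sub_mul]

theorem sum_embedding_comp_of_injective {σ : Fin n → Fin (n + 1)} (hσ : Function.Injective σ)
    (f : (Fin n → X) → K) :
    ∑ v : Fin (n + 1) ↪ X, f (v ∘ σ) = (Fintype.card X - n) * ∑ u : Fin n ↪ X, f u := by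
  obtain ⟨k, hk⟩ : ∃ k, k ∉ Set.range σ := by
    by_contra! h
    simpa using Fintype.card_le_of_surjective σ h
  rw [← sum_embedding_comp_succ,
    ← sum_embedding_comp (Fin.cons_injective_iff.2 ⟨hk, hσ⟩) fun v => f (v ∘ Fin.succ)]
  rfl

theorem sum_embedding_one (n : ℕ) :
    ∑ _v : Fin n ↪ X, (1 : K) = ∏ i ∈ Finset.range n, ((Fintype.card X : K) - i) := by
  induction n with
  | zero => simp
  | succ n ih =>
    rw [sum_embedding_comp_succ fun _ => (1 : K), ih, Finset.prod_range_succ, mul_comm]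

theorem sum_embedding_two :
    ∑ _v : Fin 2 ↪ X, (1 : K) = Fintype.card X * (Fintype.card X - 1) := by
  rw [sum_embedding_one]
  simp [Finset.prod_range_succ]

end EmbeddingsRing

section Weights

variable {G K : Type*} [AddCommGroup G] [CommRing K]

/-- The product of the values of `c` along the edges of the complete graph on the vertices `v i`,
an edge being weighted by the value of `c` at the difference of its ends. -/
def completeWeight {n : ℕ} (c : G → K) (v : Fin n → G) : K :=
  ∏ i, ∏ j ∈ Finset.Ioi i, c (v i - v j)

/-- The product of the values of `c` along the path `v 0, v 1, v 2`. -/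
def pathWeight (c : G → K) (v : Fin 3 → G) : K :=
  c (v 0 - v 1) * c (v 1 - v 2)

/-- The sum, over the pairs of edges at the vertex `v 0`, of the product of the values of `c`. -/
def starWeight (c : G → K) (v : Fin 4 → G) : K :=
  pathWeight c (v ∘ ![1, 0, 2]) + pathWeight c (v ∘ ![1, 0, 3]) + pathWeight c (v ∘ ![2, 0, 3])

/-- The product of the values of `c` along the edges of the triangle `v 1, v 2, v 3`, summed over
the ways to attach to it an edge ending in `v 0`. -/
def pawWeight (c : G → K) (v : Fin 4 → G) : K :=
  (c (v 0 - v 1) + c (v 0 - v 2) + c (v 0 - v 3)) *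
    (c (v 1 - v 2) * c (v 1 - v 3) * c (v 2 - v 3))

/-- The product of the values of `c` along the disjoint edges `v 0, v 1` and `v 2, v 3`. -/
def matchingWeight (c : G → K) (v : Fin 4 → G) : K :=
  c (v 0 - v 1) * c (v 2 - v 3)

/-- The product of the values of `c` along the cycle `v 0, v 2, v 1, v 3`, the complement of the
matching of `matchingWeight`. -/
def cycleWeight (c : G → K) (v : Fin 4 → G) : K :=
  c (v 0 - v 2) * c (v 2 - v 1) * (c (v 1 - v 3) * c (v 3 - v 0))

theorem completeWeight_four (c : G → K) (v : Fin 4 → G) :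
    completeWeight c v = c (v 0 - v 1) * c (v 2 - v 3) * (c (v 0 - v 2) * c (v 1 - v 3)) *
      (c (v 0 - v 3) * c (v 1 - v 2)) := by
  have h0 : (Finset.Ioi 0 : Finset (Fin 4)) = {1, 2, 3} := by decide
  have h1 : (Finset.Ioi 1 : Finset (Fin 4)) = {2, 3} := by decide
  have h2 : (Finset.Ioi 2 : Finset (Fin 4)) = {3} := by decide
  have h3 : (Finset.Ioi 3 : Finset (Fin 4)) = ∅ := by decide
  simp only [completeWeight, Fin.prod_univ_four, Fin.isValue, h0, Finset.mem_insert,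
    Fin.reduceEq, Finset.mem_singleton, or_self, not_false_eq_true, Finset.prod_insert,
    Finset.prod_singleton, h1, h2, h3, Finset.prod_empty, mul_one]
  ring

-- Only the subgraphs with an even number of edges survive; those with two and with four edges are
-- grouped by a vertex (stars and paws) and by a perfect matching.
theorem completeWeight_one_add_add_one_sub {c : G → K} (hneg : ∀ x, c (-x) = c x)
    (v : Fin 4 → G) :
    completeWeight (fun x => 1 + c x) v + completeWeight (fun x => 1 - c x) v =
      2 * (1 + ∑ i, (starWeight c (v ∘ Equiv.swap 0 i) + pawWeight c (v ∘ Equiv.swap 0 i)) +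
        ∑ i : Fin 3, (matchingWeight c (v ∘ Equiv.swap 1 i.succ) +
          cycleWeight c (v ∘ Equiv.swap 1 i.succ)) + completeWeight c v) := by
  have hsymm : ∀ x y, c (x - y) = c (y - x) := fun x y => by rw [← hneg, neg_sub]
  simp only [completeWeight_four, Fin.isValue, starWeight, pathWeight, Function.comp_apply,
    Matrix.cons_val_zero, Equiv.swap_apply_def, one_ne_zero, ↓reduceIte, Matrix.cons_val_one,
    Matrix.cons_val, Fin.reduceEq, pawWeight, Fin.sum_univ_succ,
    Fin.succ_zero_eq_one, Fin.succ_one_eq_two, Finset.univ_unique, Fin.default_eq_zero,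
    Finset.sum_singleton, Fin.reduceSucc, matchingWeight, Nat.reduceAdd, zero_ne_one, cycleWeight]
  simp only [hsymm (v 1) (v 0), hsymm (v 2) (v 0), hsymm (v 3) (v 0), hsymm (v 2) (v 1),
    hsymm (v 3) (v 1), hsymm (v 3) (v 2)]
  ring

end Weights

/-- An even `±1`-valued function on the nonzero elements of a finite abelian group, extended by `0`,
whose values sum to zero. -/
structure IsBalancedSign {G K : Type*} [AddCommGroup G] [Fintype G] [CommRing K] (c : G → K) :
    Prop where
  map_neg (x : G) : c (-x) = c x
  map_zero : c 0 = 0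
  mul_self {x : G} (hx : x ≠ 0) : c x * c x = 1
  sum_eq_zero : ∑ x, c x = 0

namespace IsBalancedSign

variable {G K : Type*} [AddCommGroup G] [Fintype G] [CommRing K] {c : G → K}

theorem sub_comm (hc : IsBalancedSign c) (x y : G) : c (x - y) = c (y - x) := by
  rw [← hc.map_neg, neg_sub]

theorem mul_self_sub (hc : IsBalancedSign c) {n : ℕ} (u : Fin n ↪ G) {i j : Fin n} (h : i ≠ j) :
    c (u i - u j) * c (u i - u j) = 1 :=
  hc.mul_self (sub_ne_zero.2 fun hij => h (u.injective hij))

theorem sum_sub_right (hc : IsBalancedSign c) (a : G) : ∑ x, c (x - a) = 0 :=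
  (Equiv.sum_comp (Equiv.subRight a) c).trans hc.sum_eq_zero

theorem sum_pendant_mul (hc : IsBalancedSign c) {n : ℕ} (j : Fin n) (f : (Fin n → G) → K) :
    ∑ v : Fin (n + 1) ↪ G, c (v 0 - v j.succ) * f (v ∘ Fin.succ) =
      -∑ u : Fin n ↪ G, (∑ i, c (u i - u j)) * f u := by
  rw [sum_embedding_succ fun v => c (v 0 - v j.succ) * f (v ∘ Fin.succ),
    ← Finset.sum_neg_distrib]
  refine Finset.sum_congr rfl fun u _ => ?_
  simp only [Fin.cons_zero, Fin.cons_succ, ← Finset.sum_mul, hc.sum_sub_right, zero_sub,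
    Function.comp_def, zero_mul]

theorem sum_pathWeight (hc : IsBalancedSign c) :
    ∑ u : Fin 3 ↪ G, pathWeight c u = -(Fintype.card G * (Fintype.card G - 1)) := by
  have h (u : Fin 2 ↪ G) : (∑ i, c (u i - u 0)) * c (u 0 - u 1) = 1 := by
    rw [Fin.sum_univ_two, sub_self, hc.map_zero, zero_add, hc.sub_comm,
      hc.mul_self_sub u zero_ne_one]
  rw [← sum_embedding_two, ← Finset.sum_congr rfl fun u _ => h u]
  exact hc.sum_pendant_mul 0 fun u => c (u 0 - u 1)

theorem sum_starWeight (hc : IsBalancedSign c) :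
    ∑ v : Fin 4 ↪ G, starWeight c v =
      3 * (Fintype.card G * (Fintype.card G - 1) * (3 - Fintype.card G)) := by
  simp only [starWeight, Finset.sum_add_distrib]
  simp (disch := decide) only [sum_embedding_comp_of_injective, hc.sum_pathWeight]
  push_cast
  ring

theorem sum_matchingWeight (hc : IsBalancedSign c) :
    ∑ v : Fin 4 ↪ G, matchingWeight c v = 2 * (Fintype.card G * (Fintype.card G - 1)) := by
  have h (u : Fin 3 ↪ G) : (∑ i, c (u i - u 0)) * c (u 1 - u 2) =
      pathWeight c u + pathWeight c (u ∘ ![0, 2, 1]) := by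
    simp only [Fin.isValue, Fin.sum_univ_three, sub_self, hc.map_zero, hc.sub_comm (u 1) (u 0),
      zero_add, hc.sub_comm (u 2) (u 0), pathWeight, Function.comp_apply, Matrix.cons_val_zero,
      Matrix.cons_val_one, Matrix.cons_val, hc.sub_comm (u 2) (u 1)]
    ring
  have hpath : ∑ u : Fin 3 ↪ G, pathWeight c (u ∘ ![0, 2, 1]) = _ :=
    sum_embedding_comp (by decide) _
  refine (hc.sum_pendant_mul 0 fun u => c (u 1 - u 2)).trans ?_
  simp only [h, Finset.sum_add_distrib, hpath, hc.sum_pathWeight]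
  ring

theorem sum_pawWeight (hc : IsBalancedSign c) :
    ∑ v : Fin 4 ↪ G, pawWeight c v = 6 * (Fintype.card G * (Fintype.card G - 1)) := by
  let triangle (u : Fin 3 → G) : K := c (u 0 - u 1) * c (u 0 - u 2) * c (u 1 - u 2)
  have hpaw (v : Fin 4 ↪ G) :
      pawWeight c v = ∑ j : Fin 3, c (v 0 - v j.succ) * triangle (v ∘ Fin.succ) := by
    rw [← Finset.sum_mul, Fin.sum_univ_three]
    rfl
  have htriangle (u : Fin 3 ↪ G) : ∑ j, (∑ i, c (u i - u j)) * triangle u =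
      2 * (pathWeight c u + pathWeight c (u ∘ ![0, 2, 1]) + pathWeight c (u ∘ ![1, 0, 2])) := by
    have h01 := hc.mul_self_sub u (i := 0) (j := 1) (by decide)
    have h02 := hc.mul_self_sub u (i := 0) (j := 2) (by decide)
    have h12 := hc.mul_self_sub u (i := 1) (j := 2) (by decide)
    simp only [triangle, Fin.isValue, Fin.sum_univ_three, sub_self, hc.map_zero,
      hc.sub_comm (u 1) (u 0), zero_add, add_zero, hc.sub_comm (u 2) (u 0), pathWeight,
      Function.comp_apply, Matrix.cons_val_zero, Matrix.cons_val_one, Matrix.cons_val,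
      hc.sub_comm (u 2) (u 1)]
    linear_combination 2 * c (u 0 - u 2) * c (u 1 - u 2) * h01 +
      2 * c (u 0 - u 1) * c (u 1 - u 2) * h02 + 2 * c (u 0 - u 1) * c (u 0 - u 2) * h12
  simp only [hpaw]
  rw [Finset.sum_comm]
  simp only [hc.sum_pendant_mul, Finset.sum_neg_distrib]
  rw [Finset.sum_comm]
  simp only [htriangle, ← Finset.mul_sum, Finset.sum_add_distrib]
  simp (disch := decide) only [sum_embedding_comp, hc.sum_pathWeight]
  ring

-- Two opposite vertices of the cycle are summed out by the convolution identity.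
theorem sum_cycleWeight (hc : IsBalancedSign c) {ψ : G → K} (hψ : IsBalancedSign ψ) {β : K}
    (hconv : ∀ a b, a ≠ b → ∑ x, c (a - x) * c (x - b) = β * ψ (a - b) - 1) :
    ∑ v : Fin 4 ↪ G, cycleWeight c v =
      Fintype.card G * (Fintype.card G - 1) * (β ^ 2 + 3 - Fintype.card G) := by
  let opened (u : Fin 3 → G) : K :=
    (β * ψ (u 2 - u 1) - 1) * (c (u 1 - u 0) * c (u 0 - u 2)) - 1
  have hfirst (u : Fin 3 ↪ G) : ∑ y, cycleWeight c (Fin.cons y u) -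
      ∑ i, cycleWeight c (Fin.cons (u i) u) = opened u := by
    have hcycle (y : G) : cycleWeight c (Fin.cons y u) =
        c (u 1 - u 0) * c (u 0 - u 2) * (c (u 2 - y) * c (y - u 1)) :=
      show c (y - u 1) * c (u 1 - u 0) * (c (u 0 - u 2) * c (u 2 - y)) = _ by ring
    have hsq : c (u 1 - u 0) * c (u 0 - u 2) * (c (u 2 - u 0) * c (u 0 - u 1)) = 1 := by
      rw [hc.sub_comm (u 2), hc.sub_comm (u 0) (u 1), mul_comm (c (u 0 - u 2)) (c (u 1 - u 0)),
        mul_mul_mul_comm, hc.mul_self_sub u one_ne_zero, hc.mul_self_sub u (by decide), one_mul]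
    simp only [hcycle, Fin.sum_univ_three, ← Finset.mul_sum, sub_self, hc.map_zero,
      hconv _ _ (u.injective.ne (show (2 : Fin 3) ≠ 1 by decide)), zero_mul, mul_zero, add_zero,
      hsq, opened]
    ring
  have hsecond (w : Fin 2 ↪ G) : ∑ x, opened (Fin.cons x w) -
      ∑ i, opened (Fin.cons (w i) w) = β ^ 2 + 3 - Fintype.card G - 2 * β * ψ (w 0 - w 1) := by
    have hopened (x : G) : opened (Fin.cons x w) =
        (β * ψ (w 1 - w 0) - 1) * (c (w 0 - x) * c (x - w 1)) - 1 := rfl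
    have hw : w 0 ≠ w 1 := w.injective.ne zero_ne_one
    simp only [hopened, Fin.sum_univ_two, Finset.sum_sub_distrib, ← Finset.mul_sum, hconv _ _ hw,
      sub_self, hc.map_zero, Finset.sum_const, Finset.card_univ, nsmul_one,
      Fintype.card_fin, Nat.cast_ofNat]
    rw [hψ.sub_comm (w 1)]
    linear_combination β ^ 2 * hψ.mul_self_sub w zero_ne_one
  have hψsum : ∑ w : Fin 2 ↪ G, ψ (w 0 - w 1) = 0 := by
    simpa [hψ.map_zero] using hψ.sum_pendant_mul (0 : Fin 1) fun _ => 1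
  rw [sum_embedding_succ (cycleWeight c), Finset.sum_congr rfl fun u _ => hfirst u,
    sum_embedding_succ opened, Finset.sum_congr rfl fun w _ => hsecond w,
    Finset.sum_sub_distrib, ← Finset.mul_sum, hψsum, ← sum_embedding_two, Finset.sum_mul]
  simp only [one_mul, mul_zero, sub_zero]

theorem sum_completeWeight_one_add_add_one_sub (hc : IsBalancedSign c) {ψ : G → K}
    (hψ : IsBalancedSign ψ) {β : K}
    (hconv : ∀ a b, a ≠ b → ∑ x, c (a - x) * c (x - b) = β * ψ (a - b) - 1) :
    ∑ v : Fin 4 ↪ G, completeWeight (fun x => 1 + c x) v +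
        ∑ v : Fin 4 ↪ G, completeWeight (fun x => 1 - c x) v =
      2 * ((Fintype.card G * (Fintype.card G - 1)) *
          ((Fintype.card G) ^ 2 - 20 * Fintype.card G + 81 + 3 * β ^ 2) +
        ∑ v : Fin 4 ↪ G, completeWeight c v) := by
  have hvertex : ∑ v : Fin 4 ↪ G, ∑ i,
      (starWeight c (v ∘ Equiv.swap 0 i) + pawWeight c (v ∘ Equiv.swap 0 i)) =
        4 * (Fintype.card G * (Fintype.card G - 1) * (15 - 3 * Fintype.card G)) := by
    rw [Finset.sum_comm]
    simp only [Finset.sum_add_distrib, sum_embedding_comp (Equiv.injective _), hc.sum_starWeight,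
      hc.sum_pawWeight, Finset.sum_const, Finset.card_univ, Fintype.card_fin, nsmul_eq_mul]
    push_cast
    ring
  have hmatching : ∑ v : Fin 4 ↪ G, ∑ i : Fin 3,
      (matchingWeight c (v ∘ Equiv.swap 1 i.succ) + cycleWeight c (v ∘ Equiv.swap 1 i.succ)) =
        3 * (Fintype.card G * (Fintype.card G - 1) * (β ^ 2 + 5 - Fintype.card G)) := by
    rw [Finset.sum_comm]
    simp only [Finset.sum_add_distrib, sum_embedding_comp (Equiv.injective _),
      hc.sum_matchingWeight, hc.sum_cycleWeight hψ hconv, Finset.sum_const, Finset.card_univ,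
      Fintype.card_fin, nsmul_eq_mul]
    push_cast
    ring
  simp only [← Finset.sum_add_distrib (s := (Finset.univ : Finset (Fin 4 ↪ G))),
    completeWeight_one_add_add_one_sub hc.map_neg, ← Finset.mul_sum]
  rw [Finset.sum_add_distrib, Finset.sum_add_distrib, Finset.sum_add_distrib, hvertex, hmatching,
    sum_embedding_one]
  simp only [Finset.prod_range_succ, Finset.range_zero, Finset.prod_empty]
  push_cast
  ring

end IsBalancedSign

section HalfOneAdd

variable {G K : Type*} [AddCommGroup G] [Fintype G]

theorem sum_completeWeight_comp [CommRing K] {n : ℕ} (τ : G ≃+ G) (w : G → K) :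
    ∑ v : Fin n ↪ G, completeWeight (fun x => w (τ x)) v =
      ∑ v : Fin n ↪ G, completeWeight w v := by
  refine Fintype.sum_equiv ((Equiv.refl (Fin n)).embeddingCongr τ.toEquiv) _ _ fun v => ?_
  simp [completeWeight]

theorem sum_completeWeight_eq_sum_embedding [CommRing K] {w : G → K} (h0 : w 0 = 0) (n : ℕ) :
    ∑ v : Fin n → G, completeWeight w v = ∑ v : Fin n ↪ G, completeWeight w v := by
  symm
  refine Fintype.sum_of_injective (fun v : Fin n ↪ G => ⇑v) DFunLike.coe_injective _ _ ?_
    fun v => rfl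
  intro v hv
  obtain ⟨i, j, hne, hij⟩ : ∃ i j, i < j ∧ v i = v j := by
    by_contra! h
    exact hv ⟨⟨v, .of_lt_imp_ne h⟩, rfl⟩
  exact Finset.prod_eq_zero (Finset.mem_univ i)
    (Finset.prod_eq_zero (Finset.mem_Ioi.2 hne) (by rw [hij, sub_self, h0]))

theorem sum_completeWeight_half_one_add [DecidableEq G] [Field K] [CharZero K] {c ψ : G → K}
    (hc : IsBalancedSign c) (hψ : IsBalancedSign ψ) (τ : G ≃+ G) (hflip : ∀ x, c (τ x) = -c x)
    {β : K} (hconv : ∀ a b, a ≠ b → ∑ x, c (a - x) * c (x - b) = β * ψ (a - b) - 1) :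
    ∑ v : Fin 4 → G, completeWeight (fun x => if x = 0 then 0 else (1 + c x) / 2) v =
      (Fintype.card G * (Fintype.card G - 1) *
          ((Fintype.card G) ^ 2 - 20 * Fintype.card G + 81 + 3 * β ^ 2) +
        ∑ v : Fin 4 → G, completeWeight c v) / 64 := by
  have hhalf (v : Fin 4 ↪ G) : completeWeight (fun x => if x = 0 then 0 else (1 + c x) / 2) v =
      completeWeight (fun x => 1 + c x) v / 64 := by
    have hne {i j : Fin 4} (h : i ≠ j) : v i - v j ≠ 0 := sub_ne_zero.2 (v.injective.ne h)
    simp (disch := decide) only [completeWeight_four, if_neg (hne _)]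
    ring
  have hsub : ∑ v : Fin 4 ↪ G, completeWeight (fun x => 1 - c x) v =
      ∑ v : Fin 4 ↪ G, completeWeight (fun x => 1 + c x) v := by
    simpa only [hflip, ← sub_eq_add_neg] using sum_completeWeight_comp τ fun x => 1 + c x
  have hsum := hc.sum_completeWeight_one_add_add_one_sub hψ hconv
  rw [sum_completeWeight_eq_sum_embedding (by simp), Finset.sum_congr rfl fun v _ => hhalf v,
    ← Finset.sum_div, sum_completeWeight_eq_sum_embedding hc.map_zero]
  congr 1
  rw [hsub, ← two_mul] at hsum
  exact mul_left_cancel₀ two_ne_zero hsum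

end HalfOneAdd

section MulChar

theorem mulChar_neg {R K : Type*} [CommRing R] [CommMonoidWithZero K] {χ : MulChar R K}
    (hm : χ (-1) = 1) (x : R) : χ (-x) = χ x := by
  rw [← neg_one_mul, map_mul, hm, one_mul]

theorem mulChar_inv_neg_one {R K : Type*} [CommRing R] [CommMonoidWithZero K] {χ : MulChar R K}
    (hm : χ (-1) = 1) : χ⁻¹ (-1) = 1 := by
  rw [MulChar.inv_apply_eq_inv, hm, Ring.inverse_one]

variable {F K : Type*} [Field F] [Field K] {χ : MulChar F K} {x : F}

theorem mulChar_mul_inv_apply (χ : MulChar F K) (hx : x ≠ 0) : χ x * χ⁻¹ x = 1 := by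
  rw [← MulChar.mul_apply, mul_inv_cancel, MulChar.one_apply hx.isUnit]

theorem mulChar_inv_mul_self_apply (h4 : χ ^ 4 = 1) (x : F) : χ⁻¹ x * χ⁻¹ x = χ x * χ x := by
  have h : χ⁻¹ * χ⁻¹ = χ * χ := by
    rw [← mul_inv, inv_eq_iff_mul_eq_one, ← h4, ← sq, ← sq, ← pow_mul]
  rw [← MulChar.mul_apply, h, MulChar.mul_apply]

theorem isBalancedSign_mulChar [Fintype F] (hm : χ (-1) = 1) (h2 : χ ^ 2 = 1) (h1 : χ ≠ 1) :
    IsBalancedSign χ where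
  map_neg := mulChar_neg hm
  map_zero := χ.map_zero
  mul_self hx := by rw [← MulChar.mul_apply, ← sq, h2, MulChar.one_apply hx.isUnit]
  sum_eq_zero := MulChar.sum_eq_zero_of_ne_one h1

theorem sum_convolution_mulChar [Fintype F] (A B : MulChar F K) {a b : F} (hab : a ≠ b) :
    ∑ x, A (a - x) * B (x - b) = jacobiSum A B * (A * B) (a - b) := by
  rw [jacobiSum_comm, jacobiSum, Finset.sum_mul]
  refine (Fintype.sum_equiv ((Equiv.mulLeft₀ (a - b) (sub_ne_zero.2 hab)).trans
    (Equiv.addRight b)) _ _ fun t => ?_).symm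
  have h1 : a - ((a - b) * t + b) = (a - b) * (1 - t) := by ring
  have h2 : (a - b) * t + b - b = (a - b) * t := by ring
  change _ = A (a - ((a - b) * t + b)) * B ((a - b) * t + b - b)
  rw [h1, h2, map_mul, map_mul, MulChar.mul_apply]
  ring

end MulChar

section QuarticSign

variable {F K : Type*} [Field F] [Field K]

/-- The sign function attached to a quartic character `χ` and a square root `ω` of `-1`: it is `1`
where `χ` is `1` or `ω`, and `-1` where `χ` is `-1` or `-ω`. -/
noncomputable def quarticSign (χ : MulChar F K) (ω : K) (x : F) : K :=
  ((1 - ω) * χ x + (1 + ω) * χ⁻¹ x) / 2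

variable {χ : MulChar F K} {ω : K} {t : F}

theorem mulChar_inv_apply_eq_neg (hω : ω ^ 2 = -1) (ht : χ t = ω) : χ⁻¹ t = -ω := by
  rw [MulChar.inv_apply_eq_inv', ht]
  refine inv_eq_of_mul_eq_one_right ?_
  linear_combination -hω

theorem ne_zero_of_mulChar_apply_eq (hω : ω ^ 2 = -1) (ht : χ t = ω) : t ≠ 0 := by
  rintro rfl
  simp [← ht, χ.map_zero] at hω

theorem quarticSign_zero (χ : MulChar F K) (ω : K) : quarticSign χ ω 0 = 0 := by
  simp [quarticSign, MulChar.map_zero]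

theorem quarticSign_mul_left (hω : ω ^ 2 = -1) (ht : χ t = ω) (x : F) :
    quarticSign χ ω (t * x) = quarticSign χ (-ω) x := by
  simp only [quarticSign, map_mul, ht, mulChar_inv_apply_eq_neg hω ht]
  linear_combination (-(χ x + χ⁻¹ x) / 2) * hω

theorem quarticSign_neg_mul_left (hω : ω ^ 2 = -1) (ht : χ t = ω) (x : F) :
    quarticSign χ (-ω) (t * x) = -quarticSign χ ω x := by
  simp only [quarticSign, map_mul, ht, mulChar_inv_apply_eq_neg hω ht]
  linear_combination (χ x + χ⁻¹ x) / 2 * hω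

theorem isBalancedSign_quarticSign [Fintype F] [CharZero K] (hm : χ (-1) = 1) (h4 : χ ^ 4 = 1)
    (h1 : χ ≠ 1) (hω : ω ^ 2 = -1) : IsBalancedSign (quarticSign χ ω) where
  map_neg x := by
    rw [quarticSign, mulChar_neg hm, mulChar_neg (mulChar_inv_neg_one hm), quarticSign]
  map_zero := quarticSign_zero χ ω
  mul_self {x} hx := by
    rw [quarticSign]
    linear_combination (1 + ω) ^ 2 / 4 * mulChar_inv_mul_self_apply h4 x +
      (1 - ω ^ 2) / 2 * mulChar_mul_inv_apply χ hx + (χ x ^ 2 - 1) / 2 * hω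
  sum_eq_zero := by
    simp only [quarticSign, ← Finset.sum_div, Finset.sum_add_distrib, ← Finset.mul_sum,
      MulChar.sum_eq_zero_of_ne_one h1, MulChar.sum_eq_zero_of_ne_one (inv_ne_one.2 h1), mul_zero,
      add_zero, zero_div]

theorem sum_quarticSign_mul_quarticSign [Fintype F] [CharZero K] (hm : χ (-1) = 1)
    (h4 : χ ^ 4 = 1) (h1 : χ ≠ 1) (hω : ω ^ 2 = -1) {a b : F} (hab : a ≠ b) :
    ∑ x, quarticSign χ ω (a - x) * quarticSign χ ω (x - b) =
      -ω * (jacobiSum χ χ - jacobiSum χ⁻¹ χ⁻¹) / 2 * (χ ^ 2) (a - b) - 1 := by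
  have hone : (1 : MulChar F K) (a - b) = 1 := MulChar.one_apply (sub_ne_zero.2 hab).isUnit
  have hpp := sum_convolution_mulChar χ χ hab
  have hpm := sum_convolution_mulChar χ χ⁻¹ hab
  have hmp := sum_convolution_mulChar χ⁻¹ χ hab
  have hmm := sum_convolution_mulChar χ⁻¹ χ⁻¹ hab
  rw [mul_inv_cancel, hone, jacobiSum_nontrivial_inv h1, hm] at hpm
  rw [jacobiSum_comm, inv_mul_cancel, hone, jacobiSum_nontrivial_inv h1, hm] at hmp
  rw [MulChar.mul_apply] at hpp
  rw [MulChar.mul_apply, mulChar_inv_mul_self_apply h4] at hmm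
  have hexpand (x : F) : quarticSign χ ω (a - x) * quarticSign χ ω (x - b) =
      (1 - ω) ^ 2 / 4 * (χ (a - x) * χ (x - b)) + (1 - ω ^ 2) / 4 * (χ (a - x) * χ⁻¹ (x - b)) +
      (1 - ω ^ 2) / 4 * (χ⁻¹ (a - x) * χ (x - b)) +
      (1 + ω) ^ 2 / 4 * (χ⁻¹ (a - x) * χ⁻¹ (x - b)) := by
    rw [quarticSign, quarticSign]
    ring
  simp only [hexpand, Finset.sum_add_distrib, ← Finset.mul_sum, hpp, hpm, hmp, hmm, sq χ,
    MulChar.mul_apply]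
  linear_combination (χ (a - b) * χ (a - b) * (jacobiSum χ χ + jacobiSum χ⁻¹ χ⁻¹) / 4 + 1 / 2) * hω

end QuarticSign

section AffineInvariance

variable {F X K : Type*} [Field F] [Fintype F]

theorem sum_fin_succ_eq_sum_cons [Fintype X] [AddCommMonoid K] {n : ℕ} (f : (Fin (n + 1) → X) → K) :
    ∑ v, f v = ∑ a, ∑ u : Fin n → X, f (Fin.cons a u) := by
  rw [← (Fin.consEquiv fun _ => X).sum_comp f, Fintype.sum_prod_type]
  rfl

theorem sum_eq_of_affine_invariant [CommRing K] {n : ℕ} (f : (Fin (n + 2) → F) → K)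
    (hadd : ∀ t v, f (fun i => t + v i) = f v) (hmul : ∀ s ≠ 0, ∀ v, f (fun i => s * v i) = f v)
    (hzero : ∀ v, v 0 = v 1 → f v = 0) :
    ∑ v, f v = Fintype.card F * (Fintype.card F - 1) *
      ∑ w : Fin n → F, f (Fin.cons 0 (Fin.cons 1 w)) := by
  classical
  have hfirst (a : F) : ∑ u : Fin (n + 1) → F, f (Fin.cons a u) =
      ∑ u : Fin (n + 1) → F, f (Fin.cons 0 u) := by
    refine (Fintype.sum_equiv (Equiv.piCongrRight fun _ => Equiv.addLeft a) _ _ fun u => ?_).symm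
    rw [← hadd a]
    congr 1
    ext i
    cases i using Fin.cases <;> simp
  have hsecond (b : F) : ∑ w : Fin n → F, f (Fin.cons 0 (Fin.cons b w)) =
      if b ≠ 0 then ∑ w : Fin n → F, f (Fin.cons 0 (Fin.cons 1 w)) else 0 := by
    split_ifs with hb
    · refine (Fintype.sum_equiv (Equiv.piCongrRight fun _ => Equiv.mulLeft₀ b hb) _ _
        fun w => ?_).symm
      rw [← hmul b hb]
      congr 1
      ext i
      cases i using Fin.cases with
      | zero => simp
      | succ i => cases i using Fin.cases <;> simp
    · refine Finset.sum_eq_zero fun w _ => hzero _ ?_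
      simpa using (not_not.1 hb).symm
  rw [sum_fin_succ_eq_sum_cons, Finset.sum_congr rfl fun a _ => hfirst a, Finset.sum_const,
    sum_fin_succ_eq_sum_cons, Finset.sum_congr rfl fun b _ => hsecond b, ← Finset.sum_filter,
    Finset.sum_const, Finset.filter_ne', Finset.card_erase_of_mem (Finset.mem_univ 0),
    Finset.card_univ, nsmul_eq_mul, nsmul_eq_mul, Nat.cast_pred Fintype.card_pos, mul_assoc]

end AffineInvariance

section DoubleCharSum

/-- The double character sum to which both the weighted sums over quadruples of points and the
values `₃F₂(1)` reduce. -/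
noncomputable def doubleCharSum {R K : Type*} [CommRing R] [Fintype R] [CommRing K]
    (A B C D E : MulChar R K) : K :=
  ∑ x, ∑ y, A x * B y * C (1 - x) * D (1 - y) * E (x - y)

/-- The double character sum of a triangle weighted by `χ` and the complementary star weighted by
`χ⁻¹`. -/
noncomputable def triangleSum {R K : Type*} [CommRing R] [Fintype R] [CommRing K]
    (χ : MulChar R K) : K :=
  doubleCharSum χ χ χ⁻¹ χ⁻¹ χ

/-- The double character sum of a spanning path on four points weighted by `χ` and the
complementary path weighted by `χ⁻¹`. -/
noncomputable def pathSum {R K : Type*} [CommRing R] [Fintype R] [CommRing K]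
    (χ : MulChar R K) : K :=
  doubleCharSum χ χ⁻¹ χ⁻¹ χ⁻¹ χ

variable {F K : Type*} [Field F]

theorem doubleCharSum_eq_inv [Fintype F] [CommRing K] (A B C D E : MulChar F K) :
    doubleCharSum A B C D E =
      (C * D * E) (-1) * doubleCharSum (A * C * E)⁻¹ (B * D * E)⁻¹ C D E := by
  simp only [doubleCharSum, Finset.mul_sum]
  refine Fintype.sum_equiv (Equiv.inv F) _ _ fun x => Fintype.sum_equiv (Equiv.inv F) _ _
    fun y => ?_
  by_cases hx : x = 0
  · simp [hx, MulChar.map_zero]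
  by_cases hy : y = 0
  · simp [hy, MulChar.map_zero]
  have hcancel {ψ : MulChar F K} {z : F} (hz : z ≠ 0) : ψ z * ψ z⁻¹ = 1 := by
    rw [← map_mul, mul_inv_cancel₀ hz, map_one]
  have h1x : 1 - x⁻¹ = -1 * ((1 - x) * x⁻¹) := by field_simp; ring
  have h1y : 1 - y⁻¹ = -1 * ((1 - y) * y⁻¹) := by field_simp; ring
  have hxy : x⁻¹ - y⁻¹ = -1 * ((x - y) * x⁻¹ * y⁻¹) := by field_simp; ring
  have hsq (ψ : MulChar F K) : ψ (-1) * ψ (-1) = 1 := by rw [← map_mul]; simp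
  have hone : C (-1) * C (-1) * (D (-1) * D (-1)) * (E (-1) * E (-1)) * (C x * C x⁻¹) *
      (E x * E x⁻¹) * (D y * D y⁻¹) * (E y * E y⁻¹) = 1 := by
    simp only [hsq, hcancel hx, hcancel hy, one_mul]
  simp only [Equiv.inv_apply, MulChar.inv_apply', inv_inv, MulChar.mul_apply, h1x, h1y, hxy,
    map_mul]
  linear_combination -(A x * B y * C (1 - x) * D (1 - y) * E (x - y)) * hone

/-- The product of the values of six characters along the edges of the complete graph on four
points. The edges are oriented so that `v 0 = 0` and `v 1 = 1` give a term of `doubleCharSum`. -/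
noncomputable def tetraWeight [CommRing K] (ψ₀₁ ψ₀₂ ψ₀₃ ψ₁₂ ψ₁₃ ψ₂₃ : MulChar F K)
    (v : Fin 4 → F) : K :=
  ψ₀₁ (v 1 - v 0) * ψ₀₂ (v 2 - v 0) * ψ₀₃ (v 3 - v 0) * ψ₁₂ (v 1 - v 2) * ψ₁₃ (v 1 - v 3) *
    ψ₂₃ (v 2 - v 3)

theorem sum_tetraWeight [Fintype F] [CommRing K] {ψ₀₁ ψ₀₂ ψ₀₃ ψ₁₂ ψ₁₃ ψ₂₃ : MulChar F K}
    (h : ψ₀₁ * ψ₀₂ * ψ₀₃ * ψ₁₂ * ψ₁₃ * ψ₂₃ = 1) :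
    ∑ v : Fin 4 → F, tetraWeight ψ₀₁ ψ₀₂ ψ₀₃ ψ₁₂ ψ₁₃ ψ₂₃ v =
      Fintype.card F * (Fintype.card F - 1) * doubleCharSum ψ₀₂ ψ₀₃ ψ₁₂ ψ₁₃ ψ₂₃ := by
  rw [sum_eq_of_affine_invariant]
  · congr 1
    rw [← (finTwoArrowEquiv F).symm.sum_comp, Fintype.sum_prod_type, doubleCharSum]
    refine Finset.sum_congr rfl fun x _ => Finset.sum_congr rfl fun y _ => ?_
    change ψ₀₁ (1 - 0) * ψ₀₂ (x - 0) * ψ₀₃ (y - 0) * ψ₁₂ (1 - x) * ψ₁₃ (1 - y) * ψ₂₃ (x - y) = _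
    rw [sub_zero, sub_zero, sub_zero, map_one, one_mul]
  · intro t v
    simp only [tetraWeight, add_sub_add_left_eq_sub]
  · intro s hs v
    have hprod : ψ₀₁ s * ψ₀₂ s * ψ₀₃ s * ψ₁₂ s * ψ₁₃ s * ψ₂₃ s = 1 := by
      simp only [← MulChar.mul_apply, h, MulChar.one_apply hs.isUnit]
    rw [← one_mul (tetraWeight _ _ _ _ _ _ v), ← hprod]
    simp only [tetraWeight, ← mul_sub, map_mul]
    ring
  · intro v hv
    simp [tetraWeight, hv, MulChar.map_zero]

end DoubleCharSum

section QuarticTetra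

variable {F K : Type*} [Field F] [Field K]

/-- The product of the values of `χ` along the triangle `v 0, v 2, v 3` and of `χ⁻¹` along the
remaining edges. -/
noncomputable def triangleWeight (χ : MulChar F K) : (Fin 4 → F) → K :=
  tetraWeight χ⁻¹ χ χ χ⁻¹ χ⁻¹ χ

/-- The product of the values of `χ` along the path `v 1, v 0, v 2, v 3` and of `χ⁻¹` along the
remaining edges. -/
noncomputable def spanningPathWeight (χ : MulChar F K) : (Fin 4 → F) → K :=
  tetraWeight χ χ χ⁻¹ χ⁻¹ χ⁻¹ χ

/-- The product of the values of `χ` along the edge `v 2, v 3` and of `χ⁻¹` along the remaining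
edges. -/
noncomputable def edgeWeight (χ : MulChar F K) : (Fin 4 → F) → K :=
  tetraWeight χ⁻¹ χ⁻¹ χ⁻¹ χ⁻¹ χ⁻¹ χ

/-- The sum of `edgeWeight` over the two edges of the perfect matching `v 0, v 1` and
`v 2, v 3`. -/
noncomputable def matchingEdgeWeight (χ : MulChar F K) (v : Fin 4 → F) : K :=
  edgeWeight χ v + edgeWeight χ (v ∘ ![2, 3, 0, 1])

/-- The sum of `spanningPathWeight` over the four paths whose outer edges form the perfect matching
`v 0, v 1` and `v 2, v 3`. -/
noncomputable def matchingPathWeight (χ : MulChar F K) (v : Fin 4 → F) : K :=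
  spanningPathWeight χ v + spanningPathWeight χ (v ∘ ![0, 1, 3, 2]) +
    spanningPathWeight χ (v ∘ ![1, 0, 2, 3]) + spanningPathWeight χ (v ∘ ![1, 0, 3, 2])

variable {χ : MulChar F K} {ω : K}

theorem quarticSign_mul_quarticSign [CharZero K] (hω : ω ^ 2 = -1) (x y : F) :
    quarticSign χ ω x * quarticSign χ ω y =
      (χ x * χ⁻¹ y + χ⁻¹ x * χ y + ω * (χ⁻¹ x * χ⁻¹ y - χ x * χ y)) / 2 := by
  rw [quarticSign, quarticSign]
  linear_combination (χ x * χ y + χ⁻¹ x * χ⁻¹ y - χ x * χ⁻¹ y - χ⁻¹ x * χ y) / 4 * hω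

-- Pairing opposite edges, the terms that are odd in `ω` cancel.
theorem completeWeight_quarticSign_add [CharZero K] (hm : χ (-1) = 1) (hω : ω ^ 2 = -1)
    (v : Fin 4 → F) :
    completeWeight (quarticSign χ ω) v + completeWeight (quarticSign χ (-ω)) v =
      (∑ i, (triangleWeight χ (v ∘ Equiv.swap 1 i) + triangleWeight χ⁻¹ (v ∘ Equiv.swap 1 i)) +
        ∑ i : Fin 3, (matchingPathWeight χ (v ∘ Equiv.swap 1 i.succ) -
          (matchingEdgeWeight χ (v ∘ Equiv.swap 1 i.succ) +
            matchingEdgeWeight χ⁻¹ (v ∘ Equiv.swap 1 i.succ)))) / 4 := by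
  have hω' : (-ω) ^ 2 = -1 := by rw [neg_sq, hω]
  have hsymm (i j) : χ (v i - v j) = χ (v j - v i) := by rw [← mulChar_neg hm, neg_sub]
  have hsymm' (i j) : χ⁻¹ (v i - v j) = χ⁻¹ (v j - v i) := by
    rw [← mulChar_neg (mulChar_inv_neg_one hm), neg_sub]
  simp only [completeWeight_four, quarticSign_mul_quarticSign hω, quarticSign_mul_quarticSign hω']
  simp only [Fin.isValue, neg_mul, triangleWeight, tetraWeight, Function.comp_apply,
    Equiv.swap_apply_left, Equiv.swap_apply_def, zero_ne_one, ↓reduceIte, Fin.reduceEq, inv_inv,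
    Fin.sum_univ_succ, hsymm 2 1, hsymm 3 1, hsymm' 2 1, hsymm' 3 1, Fin.succ_zero_eq_one,
    hsymm' 1 0, hsymm 2 0, hsymm 3 0, hsymm 1 0, hsymm' 2 0, hsymm' 3 0, Fin.succ_one_eq_two,
    Finset.univ_unique, Fin.default_eq_zero, Finset.sum_singleton, Fin.reduceSucc, hsymm' 3 2,
    hsymm 3 2, matchingPathWeight, spanningPathWeight, Nat.reduceAdd, Matrix.cons_val_one,
    Matrix.cons_val_zero, Matrix.cons_val, matchingEdgeWeight, edgeWeight]
  generalize χ (v 0 - v 1) = x₁, χ (v 0 - v 2) = x₂, χ (v 0 - v 3) = x₃, χ (v 1 - v 2) = x₄,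
    χ (v 1 - v 3) = x₅, χ (v 2 - v 3) = x₆, χ⁻¹ (v 0 - v 1) = y₁, χ⁻¹ (v 0 - v 2) = y₂,
    χ⁻¹ (v 0 - v 3) = y₃, χ⁻¹ (v 1 - v 2) = y₄, χ⁻¹ (v 1 - v 3) = y₅, χ⁻¹ (v 2 - v 3) = y₆
  let B x y x' y' : K := x * y' + y * x'
  let U x y x' y' : K := y * y' - x * x'
  linear_combination (B x₁ y₁ x₆ y₆ * U x₂ y₂ x₅ y₅ * U x₃ y₃ x₄ y₄ +
    B x₂ y₂ x₅ y₅ * U x₁ y₁ x₆ y₆ * U x₃ y₃ x₄ y₄ +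
    B x₃ y₃ x₄ y₄ * U x₁ y₁ x₆ y₆ * U x₂ y₂ x₅ y₅) / 4 * hω

section Sums

variable [Fintype F]

theorem sum_triangleWeight (χ : MulChar F K) :
    ∑ v, triangleWeight χ v = Fintype.card F * (Fintype.card F - 1) * triangleSum χ :=
  sum_tetraWeight (by group)

theorem sum_matchingPathWeight (χ : MulChar F K) :
    ∑ v, matchingPathWeight χ v =
      4 * (Fintype.card F * (Fintype.card F - 1) * pathSum χ) := by
  have hpath : ∑ v, spanningPathWeight χ v =
      Fintype.card F * (Fintype.card F - 1) * pathSum χ :=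
    sum_tetraWeight (by group)
  simp only [matchingPathWeight, Finset.sum_add_distrib]
  simp (disch := decide) only [sum_comp_of_injective, hpath]
  ring

-- Inverting the coordinates other than `0`, `1` turns the complement of an edge into a star.
theorem sum_matchingEdgeWeight (hm : χ (-1) = 1) (h4 : χ ^ 4 = 1) :
    ∑ v, matchingEdgeWeight χ v =
      2 * (Fintype.card F * (Fintype.card F - 1) * triangleSum χ) := by
  have hinv : doubleCharSum χ⁻¹ χ⁻¹ χ⁻¹ χ⁻¹ χ = triangleSum χ := by
    rw [doubleCharSum_eq_inv, triangleSum]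
    simp [mulChar_inv_neg_one hm]
  have hedge : ∑ v, edgeWeight χ v = Fintype.card F * (Fintype.card F - 1) * triangleSum χ := by
    rw [← hinv]
    refine sum_tetraWeight ?_
    rw [← inv_one, ← h4]
    group
  simp only [matchingEdgeWeight, Finset.sum_add_distrib]
  simp (disch := decide) only [sum_comp_of_injective, hedge]
  ring

theorem sum_completeWeight_quarticSign [CharZero K] (hm : χ (-1) = 1) (h4 : χ ^ 4 = 1)
    (hω : ω ^ 2 = -1) {t : F} (ht : χ t = ω) :
    ∑ v : Fin 4 → F, completeWeight (quarticSign χ ω) v =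
      Fintype.card F * (Fintype.card F - 1) *
        ((3 * pathSum χ - (triangleSum χ + triangleSum χ⁻¹) / 2) / 2) := by
  have hadd := Finset.sum_congr rfl fun (v : Fin 4 → F) (_ : v ∈ Finset.univ) =>
    completeWeight_quarticSign_add hm hω v
  have hneg : ∑ v : Fin 4 → F, completeWeight (quarticSign χ (-ω)) v =
      ∑ v : Fin 4 → F, completeWeight (quarticSign χ ω) v := by
    have hcomp : quarticSign χ (-ω) = fun x => quarticSign χ ω
        (DistribMulAction.toAddEquiv₀ F t (ne_zero_of_mulChar_apply_eq hω ht) x) :=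
      funext fun x => (quarticSign_mul_left hω ht x).symm
    rw [sum_completeWeight_eq_sum_embedding (quarticSign_zero χ _), hcomp,
      sum_completeWeight_comp, ← sum_completeWeight_eq_sum_embedding (quarticSign_zero χ _)]
  have htriangles : ∑ v : Fin 4 → F, ∑ i,
      (triangleWeight χ (v ∘ Equiv.swap 1 i) + triangleWeight χ⁻¹ (v ∘ Equiv.swap 1 i)) =
        4 * (Fintype.card F * (Fintype.card F - 1) * (triangleSum χ + triangleSum χ⁻¹)) := by
    rw [Finset.sum_comm]
    simp only [Finset.sum_add_distrib, sum_comp_of_injective (Equiv.injective _),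
      sum_triangleWeight, Finset.sum_const, Finset.card_univ, Fintype.card_fin, nsmul_eq_mul]
    push_cast
    ring
  have hmatchings : ∑ v : Fin 4 → F, ∑ i : Fin 3,
      (matchingPathWeight χ (v ∘ Equiv.swap 1 i.succ) -
        (matchingEdgeWeight χ (v ∘ Equiv.swap 1 i.succ) +
          matchingEdgeWeight χ⁻¹ (v ∘ Equiv.swap 1 i.succ))) =
        3 * (Fintype.card F * (Fintype.card F - 1) *
          (4 * pathSum χ - 2 * (triangleSum χ + triangleSum χ⁻¹))) := by
    have h4' : χ⁻¹ ^ 4 = 1 := by rw [inv_pow, h4, inv_one]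
    rw [Finset.sum_comm]
    simp only [Finset.sum_sub_distrib, Finset.sum_add_distrib,
      sum_comp_of_injective (Equiv.injective _), sum_matchingPathWeight,
      sum_matchingEdgeWeight hm h4, sum_matchingEdgeWeight (mulChar_inv_neg_one hm) h4',
      Finset.sum_const, Finset.card_univ, Fintype.card_fin, nsmul_eq_mul]
    push_cast
    ring
  rw [Finset.sum_add_distrib, hneg, ← Finset.sum_div, Finset.sum_add_distrib, htriangles,
    hmatchings] at hadd
  linear_combination hadd / 2

theorem sum_completeWeight_half_one_add_quarticSign [DecidableEq F] [CharZero K]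
    (hm : χ (-1) = 1) (h4 : χ ^ 4 = 1) (h2 : χ ^ 2 ≠ 1) (hω : ω ^ 2 = -1) {t : F} (ht : χ t = ω) :
    ∑ v : Fin 4 → F, completeWeight (fun x => if x = 0 then 0 else (1 + quarticSign χ ω x) / 2) v =
      Fintype.card F * (Fintype.card F - 1) / 64 *
        ((Fintype.card F) ^ 2 - 20 * Fintype.card F + 81 -
          3 / 4 * (jacobiSum χ χ - jacobiSum χ⁻¹ χ⁻¹) ^ 2 +
          (3 * pathSum χ - (triangleSum χ + triangleSum χ⁻¹) / 2) / 2) := by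
  have h1 : χ ≠ 1 := fun h => h2 (by rw [h, one_pow])
  have hψ : IsBalancedSign ⇑(χ ^ 2) :=
    isBalancedSign_mulChar (by rw [MulChar.pow_apply' _ two_ne_zero, hm, one_pow])
      (by rw [← pow_mul, h4]) h2
  have ht0 := ne_zero_of_mulChar_apply_eq hω ht
  have hflip (x : F) : quarticSign χ ω (t * t * x) = -quarticSign χ ω x := by
    rw [mul_assoc, quarticSign_mul_left hω ht, quarticSign_neg_mul_left hω ht]
  rw [sum_completeWeight_half_one_add (isBalancedSign_quarticSign hm h4 h1 hω) hψ
    (DistribMulAction.toAddEquiv₀ F (t * t) (mul_ne_zero ht0 ht0)) hflip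
    (fun a b => sum_quarticSign_mul_quarticSign hm h4 h1 hω),
    sum_completeWeight_quarticSign hm h4 hω ht]
  linear_combination 3 / 256 * (Fintype.card F * ((Fintype.card F : K) - 1)) *
    (jacobiSum χ χ - jacobiSum χ⁻¹ χ⁻¹) ^ 2 * hω

end Sums

end QuarticTetra

section UnitSums

variable {R K : Type*} [CommRing R] [CommRing K]

theorem mulChar_apply_units_inv (χ : MulChar R K) (u : Rˣ) : χ ↑u⁻¹ = χ⁻¹ u := by
  rw [MulChar.inv_apply, Ring.inverse_unit]

variable [Fintype R]

theorem sum_eq_sum_units [Fintype Rˣ] {f : R → K} (hf : ∀ x, ¬IsUnit x → f x = 0) :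
    ∑ x, f x = ∑ u : Rˣ, f u :=
  (Fintype.sum_of_injective Units.val Units.val_injective _ _
    (fun x hx => hf x fun ⟨u, hu⟩ => hx ⟨u, hu⟩) fun _ => rfl).symm

-- Substitute `x = -w⁻¹`.
theorem jacobiSum_eq_sum_sub_one (A B : MulChar R K) :
    jacobiSum A B = B (-1) * ∑ x, A x * (A * B)⁻¹ (x - 1) := by
  classical
  have hsubst (w : Rˣ) : B ↑(-w⁻¹) * A (1 - ↑(-w⁻¹)) = B (-1) * (A (w + 1) * (A * B)⁻¹ w) := by
    have hneg : ((-w⁻¹ : Rˣ) : R) = -1 * ↑w⁻¹ := by rw [Units.val_neg, neg_one_mul]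
    have hsub : (1 : R) - -1 * ↑w⁻¹ = (w + 1) * ↑w⁻¹ := by
      rw [add_mul, Units.mul_inv]
      ring
    rw [hneg, hsub, map_mul, map_mul, mulChar_apply_units_inv, mulChar_apply_units_inv, mul_inv,
      MulChar.mul_apply]
    ring
  calc jacobiSum A B = ∑ w : Rˣ, B w * A (1 - w) := by
        rw [jacobiSum_comm, jacobiSum,
          sum_eq_sum_units fun x hx => by rw [MulChar.map_nonunit _ hx, zero_mul]]
    _ = ∑ w : Rˣ, B ↑(-w⁻¹) * A (1 - ↑(-w⁻¹)) :=
        (((Equiv.inv Rˣ).trans (Equiv.neg Rˣ)).sum_comp fun w : Rˣ => B w * A (1 - w)).symm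
    _ = B (-1) * ∑ w : Rˣ, A (w + 1) * (A * B)⁻¹ w := by
        simp only [hsubst, Finset.mul_sum]
    _ = B (-1) * ∑ x, A (x + 1) * (A * B)⁻¹ x := by
        rw [sum_eq_sum_units (f := fun x => A (x + 1) * (A * B)⁻¹ x) fun x hx => by
          rw [MulChar.map_nonunit _ hx, mul_zero]]
    _ = B (-1) * ∑ x, A x * (A * B)⁻¹ (x - 1) := by
        rw [← (Equiv.subRight (1 : R)).sum_comp]
        simp

end UnitSums

section Hypergeometric

variable {q : ℕ} [NeZero q]

theorem dirichletBinom_mul_eq_sum (A B χ : DirichletCharacter ℂ q) :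
    dirichletBinom (A * χ) (B * χ) =
      (q : ℂ)⁻¹ * ∑ u : (ZMod q)ˣ, A u * (A⁻¹ * B) (u - 1) * χ u := by
  have hsign : (B * χ) (-1) * (B * χ)⁻¹ (-1) = 1 := by
    rw [← MulChar.mul_apply, mul_inv_cancel, MulChar.one_apply isUnit_one.neg]
  have hchar : (A * χ * (B * χ)⁻¹)⁻¹ = A⁻¹ * B := by
    rw [mul_inv, inv_inv, mul_inv, mul_mul_mul_comm, inv_mul_cancel, mul_one]
  have hsum : ∑ x, (A * χ) x * (A⁻¹ * B) (x - 1) =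
      ∑ u : (ZMod q)ˣ, A u * (A⁻¹ * B) (u - 1) * χ u := by
    rw [sum_eq_sum_units fun x hx => by rw [MulChar.map_nonunit _ hx, zero_mul]]
    exact Finset.sum_congr rfl fun u _ => by rw [MulChar.mul_apply]; ring
  rw [dirichletBinom, jacobiSum_eq_sum_sub_one, hchar, hsum]
  linear_combination (q : ℂ)⁻¹ * (∑ u : (ZMod q)ˣ, A u * (A⁻¹ * B) (u - 1) * χ u) * hsign

theorem sum_mul_mul_dirichletCharacter (f g h : (ZMod q)ˣ → ℂ) :
    ∑ χ : DirichletCharacter ℂ q, (∑ u, f u * χ u) * (∑ u, g u * χ u) * (∑ u, h u * χ u) =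
      q.totient * ∑ a, ∑ b, f a * g b⁻¹ * h (b * a⁻¹) := by
  have hexpand (χ : DirichletCharacter ℂ q) :
      (∑ u, f u * χ u) * (∑ u, g u * χ u) * (∑ u, h u * χ u) =
        ∑ a, ∑ b, ∑ c, f a * g b⁻¹ * h c * χ (a * b⁻¹ * c : (ZMod q)ˣ) := by
    rw [← Equiv.sum_comp (Equiv.inv (ZMod q)ˣ) fun u => g u * χ u, Finset.sum_mul_sum,
      Finset.sum_mul]
    simp_rw [Finset.sum_mul_sum]
    refine Finset.sum_congr rfl fun a _ => Finset.sum_congr rfl fun b _ =>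
      Finset.sum_congr rfl fun c _ => ?_
    rw [Units.val_mul, Units.val_mul, map_mul, map_mul, Equiv.inv_apply]
    ring
  have horth (a b c : (ZMod q)ˣ) : ∑ χ : DirichletCharacter ℂ q, χ (a * b⁻¹ * c : (ZMod q)ˣ) =
      if b * a⁻¹ = c then (q.totient : ℂ) else 0 := by
    have hone : ((a * b⁻¹ * c : (ZMod q)ˣ) : ZMod q) = 1 ↔ b * a⁻¹ = c := by
      rw [Units.val_eq_one, mul_eq_one_iff_inv_eq, mul_inv, inv_inv, mul_comm a⁻¹]
    simp only [DirichletCharacter.sum_characters_eq, hone]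
  simp only [hexpand]
  rw [Finset.sum_comm, Finset.mul_sum]
  refine Finset.sum_congr rfl fun a _ => ?_
  rw [Finset.sum_comm, Finset.mul_sum]
  refine Finset.sum_congr rfl fun b _ => ?_
  rw [Finset.sum_comm]
  simp only [← Finset.mul_sum, horth, mul_ite, mul_zero, Finset.sum_ite_eq, Finset.mem_univ,
    if_true]
  ring

theorem doubleCharSum_eq_sum_units (A B C D E : DirichletCharacter ℂ q) :
    doubleCharSum A B C D E =
      ∑ a : (ZMod q)ˣ, ∑ b : (ZMod q)ˣ, A a * B b * C (1 - a) * D (1 - b) * E (a - b) := by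
  rw [doubleCharSum, sum_eq_sum_units fun x hx => ?_]
  · refine Finset.sum_congr rfl fun a _ => sum_eq_sum_units fun y hy => ?_
    simp [MulChar.map_nonunit B hy]
  · simp [MulChar.map_nonunit A hx]

theorem sum_units_eq_doubleCharSum (A₀ A₁ A₂ B₁ B₂ : DirichletCharacter ℂ q) :
    ∑ a : (ZMod q)ˣ, ∑ b : (ZMod q)ˣ,
        A₀ a * A₀⁻¹ (a - 1) * (A₁ ↑b⁻¹ * (A₁⁻¹ * B₁) (↑b⁻¹ - 1)) *
          (A₂ ↑(b * a⁻¹) * (A₂⁻¹ * B₂) (↑(b * a⁻¹) - 1)) =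
      (A₀⁻¹ * A₂⁻¹ * B₂) (-1) *
        doubleCharSum (A₀ * B₂⁻¹) (A₂ * B₁⁻¹) A₀⁻¹ (A₁⁻¹ * B₁) (A₂⁻¹ * B₂) := by
  rw [doubleCharSum_eq_sum_units]
  simp only [Finset.mul_sum]
  refine Finset.sum_congr rfl fun a _ => Finset.sum_congr rfl fun b _ => ?_
  have ha : (a : ZMod q) - 1 = -1 * (1 - a) := by ring
  have hb : (↑b⁻¹ : ZMod q) - 1 = (1 - b) * ↑b⁻¹ := by
    rw [sub_mul, Units.mul_inv, one_mul]
  have hab : ((b * a⁻¹ : (ZMod q)ˣ) : ZMod q) - 1 = -1 * ((a - b) * ↑a⁻¹) := by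
    rw [sub_mul, Units.mul_inv, Units.val_mul]
    ring
  have hcancel (χ : DirichletCharacter ℂ q) (u : (ZMod q)ˣ) : χ u * χ⁻¹ u = 1 := by
    rw [← MulChar.mul_apply, mul_inv_cancel, MulChar.one_apply u.isUnit]
  rw [hab, ha, hb, Units.val_mul]
  simp only [map_mul, mulChar_apply_units_inv, MulChar.mul_apply, mul_inv, inv_inv]
  linear_combination A₀ a * A₀⁻¹ (-1) * A₀⁻¹ (1 - a) * A₁⁻¹ (1 - b) * B₁⁻¹ b * B₁ (1 - b) *
    A₂ b * A₂⁻¹ (-1) * A₂⁻¹ (a - b) * B₂⁻¹ a * B₂ (-1) * B₂ (a - b) *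
    (A₂ a * A₂⁻¹ a * hcancel A₁ b + hcancel A₂ a)

theorem sq_mul_dirichletHypergeometric_one (A₀ A₁ A₂ B₁ B₂ : DirichletCharacter ℂ q) :
    (q : ℂ) ^ 2 * dirichletHypergeometric A₀ ![A₁, A₂] ![B₁, B₂] 1 =
      (A₀⁻¹ * A₂⁻¹ * B₂) (-1) *
        doubleCharSum (A₀ * B₂⁻¹) (A₂ * B₁⁻¹) A₀⁻¹ (A₁⁻¹ * B₁) (A₂⁻¹ * B₂) := by
  have hq : (q : ℂ) ≠ 0 := Nat.cast_ne_zero.2 (NeZero.ne q)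
  have hφ : (q.totient : ℂ) ≠ 0 :=
    Nat.cast_ne_zero.2 (Nat.totient_pos.2 (Nat.pos_of_ne_zero (NeZero.ne q))).ne'
  have hprod (χ : DirichletCharacter ℂ q) :
      dirichletBinom (A₀ * χ) χ *
        (∏ i : Fin 2, dirichletBinom (![A₁, A₂] i * χ) (![B₁, B₂] i * χ)) * χ 1 =
      ((q : ℂ)⁻¹) ^ 3 * ((∑ u : (ZMod q)ˣ, A₀ u * A₀⁻¹ (u - 1) * χ u) *
        (∑ u : (ZMod q)ˣ, A₁ u * (A₁⁻¹ * B₁) (u - 1) * χ u) *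
        (∑ u : (ZMod q)ˣ, A₂ u * (A₂⁻¹ * B₂) (u - 1) * χ u)) := by
    have h0 := dirichletBinom_mul_eq_sum A₀ 1 χ
    rw [one_mul, mul_one] at h0
    simp only [Fin.prod_univ_two, map_one, Matrix.cons_val_zero, Matrix.cons_val_one,
      Matrix.cons_val_fin_one, h0, dirichletBinom_mul_eq_sum]
    ring
  rw [dirichletHypergeometric, Finset.sum_congr rfl fun χ _ => hprod χ, ← Finset.mul_sum,
    sum_mul_mul_dirichletCharacter (fun u : (ZMod q)ˣ => A₀ u * A₀⁻¹ (u - 1))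
      (fun u : (ZMod q)ˣ => A₁ u * (A₁⁻¹ * B₁) (u - 1))
      (fun u : (ZMod q)ˣ => A₂ u * (A₂⁻¹ * B₂) (u - 1)), sum_units_eq_doubleCharSum]
  field_simp

end Hypergeometric

section Fibers

theorem card_smul_sum_comp_of_surjective {A B M : Type*} [AddGroup A] [AddGroup B] [Fintype A]
    [Fintype B] [AddCommMonoid M] (π : A →+ B) (hπ : Function.Surjective π) (f : B → M) :
    Fintype.card B • ∑ a, f (π a) = Fintype.card A • ∑ b, f b := by
  obtain ⟨s, hs⟩ := hπ.hasRightInverse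
  have hright (b : B) : ∑ a, f (π a) = ∑ a, f (π a + b) :=
    (Fintype.sum_equiv (Equiv.addRight (s b)) _ _ fun a => by simp [hs b]).symm
  have hleft (a : A) : ∑ b, f (π a + b) = ∑ b, f b :=
    Fintype.sum_equiv (Equiv.addLeft (π a)) _ _ fun _ => rfl
  calc Fintype.card B • ∑ a, f (π a) = ∑ _b : B, ∑ a, f (π a) := by
        rw [Finset.sum_const, Finset.card_univ]
    _ = ∑ b, ∑ a, f (π a + b) := Finset.sum_congr rfl fun b _ => hright b
    _ = ∑ a, ∑ b, f (π a + b) := Finset.sum_comm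
    _ = Fintype.card A • ∑ b, f b := by simp only [hleft, Finset.sum_const, Finset.card_univ]

variable {p m : ℕ}

/-- The reduction map from `ℤ/p^(m+1)` to `ℤ/p`; the exponent is written `m + 1` so that it is
visibly positive. -/
def primePowReduction (p m : ℕ) : ZMod (p ^ (m + 1)) →+* ZMod p :=
  ZMod.castHom (dvd_pow_self p m.succ_ne_zero) (ZMod p)

theorem isUnit_primePowReduction [NeZero p] {x : ZMod (p ^ (m + 1))} :
    IsUnit (primePowReduction p m x) ↔ IsUnit x := by
  obtain ⟨n, rfl⟩ := ZMod.natCast_zmod_surjective x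
  rw [map_natCast, ZMod.isUnit_iff_coprime, ZMod.isUnit_iff_coprime,
    Nat.coprime_pow_right_iff m.succ_pos]

variable {K : Type*} [Field K] [CharZero K] [Fact p.Prime]

theorem sum_comp_primePowReduction (f : ZMod p → K) :
    ∑ x, f (primePowReduction p m x) = (p : K) ^ m * ∑ x, f x := by
  have hp : (p : K) ≠ 0 := Nat.cast_ne_zero.2 (NeZero.ne p)
  have h := card_smul_sum_comp_of_surjective (primePowReduction p m).toAddMonoidHom
    (ZMod.ringHom_surjective _) f
  rw [ZMod.card, ZMod.card, nsmul_eq_mul, nsmul_eq_mul, Nat.cast_pow,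
    pow_succ' (p : K), mul_assoc] at h
  exact mul_left_cancel₀ hp h

theorem sum_pi_comp_primePowReduction {ι : Type*} [Fintype ι] [DecidableEq ι]
    (f : (ι → ZMod p) → K) :
    ∑ v : ι → ZMod (p ^ (m + 1)), f (primePowReduction p m ∘ v) =
      (p : K) ^ (m * Fintype.card ι) * ∑ v, f v := by
  have hp : (p : K) ^ Fintype.card ι ≠ 0 := pow_ne_zero _ (Nat.cast_ne_zero.2 (NeZero.ne p))
  have h := card_smul_sum_comp_of_surjective ((primePowReduction p m).toAddMonoidHom.compLeft ι)
    (ZMod.ringHom_surjective (primePowReduction p m)).comp_left f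
  rw [Fintype.card_fun, Fintype.card_fun, ZMod.card, ZMod.card, nsmul_eq_mul, nsmul_eq_mul,
    ← pow_mul, Nat.cast_pow, Nat.cast_pow, add_one_mul, pow_add (p : K), mul_assoc,
    mul_left_comm] at h
  exact mul_left_cancel₀ hp h

end Fibers

section ChangeLevel

open DirichletCharacter

variable {p m : ℕ} [Fact p.Prime]

theorem card_ker_unitsMap_primePow (h : p ∣ p ^ (m + 1)) :
    Nat.card (ZMod.unitsMap h).ker = p ^ m := by
  have hprime : p.Prime := Fact.out
  have hcard := Subgroup.card_mul_index (ZMod.unitsMap h).ker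
  rw [Subgroup.index_ker, MonoidHom.range_eq_top.2 (ZMod.unitsMap_surjective h),
    Subgroup.card_top, Nat.card_eq_fintype_card (α := (ZMod p)ˣ),
    Nat.card_eq_fintype_card (α := (ZMod (p ^ (m + 1)))ˣ), ZMod.card_units_eq_totient,
    ZMod.card_units_eq_totient, Nat.totient_prime_pow_succ hprime,
    Nat.totient_prime hprime] at hcard
  exact Nat.eq_of_mul_eq_mul_right (Nat.sub_pos_of_lt hprime.one_lt) hcard

-- The kernel of `(ℤ/p^(m+1))ˣ → (ℤ/p)ˣ` is a `p`-group, so `χ` is trivial on it.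
theorem factorsThrough_of_coprime_orderOf {K : Type*} [CommMonoidWithZero K]
    {χ : DirichletCharacter K (p ^ (m + 1))} (hχ : (orderOf χ).Coprime p) :
    χ.FactorsThrough p := by
  have hdvd : p ∣ p ^ (m + 1) := dvd_pow_self p m.succ_ne_zero
  rw [factorsThrough_iff_ker_unitsMap hdvd]
  intro u hu
  have hord : orderOf (χ.toUnitHom u) ∣ p ^ m := by
    refine (orderOf_map_dvd χ.toUnitHom u).trans ?_
    rw [← card_ker_unitsMap_primePow hdvd]
    exact Subgroup.orderOf_dvd_natCard _ hu
  have hord' : orderOf (χ.toUnitHom u) ∣ orderOf χ := by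
    refine orderOf_dvd_of_pow_eq_one (Units.ext ?_)
    rw [Units.val_pow_eq_pow_val, MulChar.coe_toUnitHom, ← MulChar.pow_apply_coe,
      pow_orderOf_eq_one, MulChar.one_apply u.isUnit, Units.val_one]
  exact orderOf_eq_one_iff.1 (Nat.eq_one_of_dvd_coprimes (hχ.pow_right m) hord' hord)

theorem changeLevel_apply_primePow {K : Type*} [CommMonoidWithZero K] (h : p ∣ p ^ (m + 1))
    (χ : DirichletCharacter K p) (x : ZMod (p ^ (m + 1))) :
    changeLevel h χ x = χ (primePowReduction p m x) := by
  by_cases hx : IsUnit x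
  · obtain ⟨u, rfl⟩ := hx
    exact changeLevel_eq_cast_of_dvd _ _ _
  · rw [MulChar.map_nonunit _ hx, MulChar.map_nonunit _ (isUnit_primePowReduction.not.2 hx)]

variable {K : Type*} [Field K] [CharZero K]

theorem jacobiSum_changeLevel_primePow (h : p ∣ p ^ (m + 1)) (A B : DirichletCharacter K p) :
    jacobiSum (changeLevel h A) (changeLevel h B) = (p : K) ^ m * jacobiSum A B := by
  rw [jacobiSum, jacobiSum, ← sum_comp_primePowReduction]
  simp only [changeLevel_apply_primePow, map_sub, map_one]

theorem doubleCharSum_changeLevel_primePow (h : p ∣ p ^ (m + 1))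
    (A B C D E : DirichletCharacter K p) :
    doubleCharSum (changeLevel h A) (changeLevel h B) (changeLevel h C) (changeLevel h D)
      (changeLevel h E) = (p : K) ^ (2 * m) * doubleCharSum A B C D E := by
  simp only [doubleCharSum, changeLevel_apply_primePow, map_sub, map_one]
  rw [two_mul, pow_add (p : K), mul_assoc, Finset.mul_sum, ← sum_comp_primePowReduction]
  simp only [← sum_comp_primePowReduction]

theorem triangleSum_changeLevel_primePow (h : p ∣ p ^ (m + 1)) (χ : DirichletCharacter K p) :
    triangleSum (changeLevel h χ) = (p : K) ^ (2 * m) * triangleSum χ := by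
  rw [triangleSum, triangleSum, ← map_inv, doubleCharSum_changeLevel_primePow]

theorem pathSum_changeLevel_primePow (h : p ∣ p ^ (m + 1)) (χ : DirichletCharacter K p) :
    pathSum (changeLevel h χ) = (p : K) ^ (2 * m) * pathSum χ := by
  rw [pathSum, pathSum, ← map_inv, doubleCharSum_changeLevel_primePow]

end ChangeLevel

section Characters

variable {R K : Type*} [CommRing R] {g : Rˣ}

theorem orderOf_toUnitHom_generator [CommMonoidWithZero K]
    (hg : ∀ u : Rˣ, u ∈ Subgroup.zpowers g) (χ : MulChar R K) :
    orderOf (χ.toUnitHom g) = orderOf χ := by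
  refine orderOf_eq_orderOf_iff.2 fun n => ?_
  rw [MulChar.eq_iff hg, MulChar.pow_apply_coe, MulChar.one_apply g.isUnit, Units.ext_iff,
    Units.val_pow_eq_pow_val, MulChar.coe_toUnitHom, Units.val_one]

theorem apply_generator_eq_neg_one [CommRing K] [NoZeroDivisors K]
    (hg : ∀ u : Rˣ, u ∈ Subgroup.zpowers g) {φ : MulChar R K} (hφ : orderOf φ = 2) :
    φ g = -1 := by
  rw [← orderOf_toUnitHom_generator hg, orderOf_eq_prime_iff, Units.ext_iff, Ne, Units.ext_iff,
    Units.val_pow_eq_pow_val, MulChar.coe_toUnitHom, Units.val_one, sq, mul_self_eq_one_iff] at hφ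
  exact hφ.1.resolve_left hφ.2

theorem eq_of_orderOf_eq_two [CommRing K] [NoZeroDivisors K]
    (hg : ∀ u : Rˣ, u ∈ Subgroup.zpowers g) {φ ψ : MulChar R K} (hφ : orderOf φ = 2)
    (hψ : orderOf ψ = 2) : φ = ψ := by
  rw [MulChar.eq_iff hg, apply_generator_eq_neg_one hg hφ, apply_generator_eq_neg_one hg hψ]

theorem orderOf_sq_eq_two {G : Type*} [Monoid G] {x : G} (hx : orderOf x = 4) :
    orderOf (x ^ 2) = 2 := by
  rw [orderOf_pow' x two_ne_zero, hx]
  rfl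

theorem map_eq_one_iff_mem_zpowers_pow {G H : Type*} [Group G] [Group H] {g : G}
    (hg : ∀ x, x ∈ Subgroup.zpowers g) (f : G →* H) (x : G) :
    f x = 1 ↔ x ∈ Subgroup.zpowers (g ^ orderOf (f g)) := by
  obtain ⟨k, rfl⟩ := Subgroup.mem_zpowers_iff.1 (hg x)
  rw [map_zpow, ← orderOf_dvd_iff_zpow_eq_one]
  constructor
  · rintro ⟨j, rfl⟩
    exact Subgroup.mem_zpowers_iff.2 ⟨j, by rw [zpow_mul, zpow_natCast]⟩
  · intro h
    obtain ⟨j, hj⟩ := Subgroup.mem_zpowers_iff.1 h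
    rw [orderOf_dvd_iff_zpow_eq_one, ← map_zpow, ← hj, map_zpow, map_pow, pow_orderOf_eq_one,
      one_zpow]

end Characters

section Generator

variable {n : ℕ} {g : (ZMod n)ˣ} {K : Type*} [CommMonoidWithZero K] {χ : DirichletCharacter K n}

theorem apply_eq_one_iff_mem_zpowers_pow_four (hg : ∀ u : (ZMod n)ˣ, u ∈ Subgroup.zpowers g)
    (hχ : orderOf χ = 4) (u : (ZMod n)ˣ) : χ u = 1 ↔ u ∈ Subgroup.zpowers (g ^ 4) := by
  rw [← hχ, ← orderOf_toUnitHom_generator hg, ← map_eq_one_iff_mem_zpowers_pow hg, Units.ext_iff,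
    MulChar.coe_toUnitHom, Units.val_one]

theorem mem_peisertConnectionSet_iff [Nontrivial K]
    (hg : ∀ u : (ZMod n)ˣ, u ∈ Subgroup.zpowers g) (hχ : orderOf χ = 4) (z : ZMod n) :
    z ∈ peisertConnectionSet g ↔ χ z = 1 ∨ χ z = χ g := by
  constructor
  · rintro ⟨u, hu, rfl | rfl⟩
    · exact Or.inl ((apply_eq_one_iff_mem_zpowers_pow_four hg hχ u).2 hu)
    · rw [map_mul, (apply_eq_one_iff_mem_zpowers_pow_four hg hχ u).2 hu, mul_one]
      exact Or.inr rfl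
  · intro h
    have hz : IsUnit z := by
      by_contra hz
      rw [MulChar.map_nonunit χ hz] at h
      exact h.elim zero_ne_one (g.isUnit.map χ).ne_zero.symm
    obtain ⟨u, rfl⟩ := hz
    rcases h with h | h
    · exact ⟨u, (apply_eq_one_iff_mem_zpowers_pow_four hg hχ u).1 h, Or.inl rfl⟩
    · refine ⟨g⁻¹ * u, (apply_eq_one_iff_mem_zpowers_pow_four hg hχ _).1 ?_, Or.inr ?_⟩
      · rw [Units.val_mul, map_mul, h, ← map_mul, Units.inv_mul, map_one]
      · rw [Units.val_mul, Units.mul_inv_cancel_left]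

end Generator

section FiniteField

variable {F : Type*} [Field F]

theorem mulChar_apply_pow_eq_one {K : Type*} [CommMonoidWithZero K] {χ : MulChar F K} {n : ℕ}
    (hχ : χ ^ n = 1) {x : F} (hx : x ≠ 0) : χ (x ^ n) = 1 := by
  obtain ⟨u, rfl⟩ := hx.isUnit
  rw [map_pow, ← MulChar.pow_apply_coe, hχ, MulChar.one_apply_coe]

variable [Fintype F]

theorem ringChar_ne_two_of_card_mod_eight (hF : Fintype.card F % 8 = 1) : ringChar F ≠ 2 :=
  fun h => by
    have := FiniteField.even_card_of_char_two h
    omega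

theorem mulChar_four_eq_one {K : Type*} [CommMonoidWithZero K] {χ : MulChar F K}
    (hF : Fintype.card F % 8 = 1) (h4 : χ ^ 4 = 1) : χ 4 = 1 := by
  have htwo : (2 : F) ≠ 0 := Ring.two_ne_zero (ringChar_ne_two_of_card_mod_eight hF)
  obtain ⟨s, hs⟩ := (FiniteField.isSquare_two_iff (F := F)).2 (by omega)
  have hs0 : s ≠ 0 := fun h => htwo (by rw [hs, h, mul_zero])
  have hfour : (4 : F) = s ^ 4 := by linear_combination (2 + s * s) * hs
  rw [hfour, mulChar_apply_pow_eq_one h4 hs0]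

-- With `i² = -1` one has `-4 = (1 + i)⁴`.
theorem mulChar_neg_one_eq_one {K : Type*} [CommMonoidWithZero K] {χ : MulChar F K}
    (hF : Fintype.card F % 8 = 1) (h4 : χ ^ 4 = 1) : χ (-1) = 1 := by
  have htwo : (2 : F) ≠ 0 := Ring.two_ne_zero (ringChar_ne_two_of_card_mod_eight hF)
  obtain ⟨i, hi⟩ := FiniteField.isSquare_neg_one_iff.2 (by omega : Fintype.card F % 4 ≠ 3)
  have hfour : (-1) * 4 = (1 + i) ^ 4 := by linear_combination (i * i + 4 * i + 5) * hi
  have hi0 : 1 + i ≠ 0 := fun h => by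
    rw [h, zero_pow four_ne_zero, neg_one_mul, neg_eq_zero] at hfour
    exact pow_ne_zero 2 htwo (by linear_combination hfour)
  rw [← mul_one (χ (-1)), ← mulChar_four_eq_one hF h4, ← map_mul, hfour,
    mulChar_apply_pow_eq_one h4 hi0, mulChar_four_eq_one hF h4]

end FiniteField

section Duplication

variable {F K : Type*} [Field F] [Fintype F] [Field K] [CharZero K]

theorem orderOf_quadraticChar_ringHomComp [DecidableEq F] (hF : ringChar F ≠ 2) :
    orderOf ((quadraticChar F).ringHomComp (Int.castRingHom K)) = 2 := by
  rw [orderOf_eq_prime_iff]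
  exact ⟨((quadraticChar_isQuadratic F).comp (Int.castRingHom K)).sq_eq_one,
    (MulChar.ringHomComp_ne_one_iff (RingHom.injective_int _)).2 (quadraticChar_ne_one hF)⟩

theorem sum_comp_sq (hF : ringChar F ≠ 2) {φ : MulChar F K} (hφ : orderOf φ = 2) (f : F → K) :
    ∑ x, f (x ^ 2) = ∑ y, (φ y + 1) * f y := by
  classical
  obtain ⟨g, hg⟩ := IsCyclic.exists_generator (α := Fˣ)
  have hcard (y : F) : ((Finset.univ.filter fun x : F => x ^ 2 = y).card : K) = φ y + 1 := by
    have h := quadraticChar_card_sqrts hF y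
    rw [Set.toFinset_ofPred] at h
    rw [eq_of_orderOf_eq_two hg hφ (orderOf_quadraticChar_ringHomComp hF)]
    simpa using congrArg (Int.cast : ℤ → K) h
  rw [← Finset.sum_fiberwise Finset.univ (fun x : F => x ^ 2)]
  refine Finset.sum_congr rfl fun y _ => ?_
  rw [Finset.sum_congr rfl fun x hx => by rw [(Finset.mem_filter.1 hx).2], Finset.sum_const,
    nsmul_eq_mul, hcard]

-- Completing the square: `4x(1 - x) = 1 - (2x - 1)²`.
theorem jacobiSum_duplication (hF : ringChar F ≠ 2) {χ φ : MulChar F K} (hχ : χ ≠ 1)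
    (hφ : orderOf φ = 2) : χ 4 * jacobiSum χ χ = jacobiSum χ φ := by
  have htwo : (2 : F) ≠ 0 := Ring.two_ne_zero hF
  have hsquare (x : F) : χ 4 * (χ x * χ (1 - x)) = χ (1 - (2 * x - 1) ^ 2) := by
    rw [← map_mul, ← map_mul]
    ring_nf
  have hsum : ∑ y, χ (1 - y) = 0 :=
    ((Equiv.subLeft (1 : F)).sum_comp χ).trans (MulChar.sum_eq_zero_of_ne_one hχ)
  calc χ 4 * jacobiSum χ χ = ∑ x, χ (1 - (2 * x - 1) ^ 2) := by
        simp only [jacobiSum, Finset.mul_sum, hsquare]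
    _ = ∑ x, χ (1 - x ^ 2) :=
        ((Equiv.mulLeft₀ 2 htwo).trans (Equiv.subRight 1)).sum_comp fun x => χ (1 - x ^ 2)
    _ = jacobiSum χ φ + ∑ y, χ (1 - y) := by
        rw [sum_comp_sq hF hφ fun y => χ (1 - y), jacobiSum_comm, jacobiSum]
        simp only [add_one_mul, Finset.sum_add_distrib]
    _ = jacobiSum χ φ := by
        rw [hsum, add_zero]

theorem jacobiSum_self_sq (hF : Fintype.card F % 8 = 1) {χ : MulChar F K} (hχ : orderOf χ = 4) :
    jacobiSum χ (χ ^ 2) = jacobiSum χ χ := by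
  have h4 : χ ^ 4 = 1 := by rw [← hχ, pow_orderOf_eq_one]
  have hne : χ ≠ 1 := fun h => by
    rw [h, orderOf_one] at hχ
    omega
  rw [← jacobiSum_duplication (ringChar_ne_two_of_card_mod_eight hF) hne (orderOf_sq_eq_two hχ),
    mulChar_four_eq_one hF h4, one_mul]

end Duplication

section Conjugation

variable {R : Type*} [CommRing R]

theorem conj_mulChar_apply [Finite Rˣ] (χ : MulChar R ℂ) (x : R) : starRingEnd ℂ (χ x) = χ⁻¹ x :=
  MulChar.star_apply' χ x

variable [Fintype R]

theorem conj_jacobiSum (χ ψ : MulChar R ℂ) :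
    starRingEnd ℂ (jacobiSum χ ψ) = jacobiSum χ⁻¹ ψ⁻¹ := by
  simp only [jacobiSum, map_sum, map_mul, conj_mulChar_apply]

theorem conj_triangleSum (χ : MulChar R ℂ) :
    starRingEnd ℂ (triangleSum χ) = triangleSum χ⁻¹ := by
  simp only [triangleSum, doubleCharSum, map_sum, map_mul, conj_mulChar_apply]

end Conjugation

section QuarticIndicator

variable {F K : Type*} [Field F] [Field K] {χ : MulChar F K} {ω : K}

theorem eq_or_eq_of_pow_four_eq_one (hω : ω ^ 2 = -1) {y : K} (hy : y ^ 4 = 1) :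
    y = 1 ∨ y = -1 ∨ y = ω ∨ y = -ω := by
  have hfactor : (y ^ 2 - 1 ^ 2) * (y ^ 2 - ω ^ 2) = 0 := by
    linear_combination hy - (y ^ 2 - 1) * hω
  rcases mul_eq_zero.1 hfactor with h | h
  · exact (sq_eq_sq_iff_eq_or_eq_neg.1 (sub_eq_zero.1 h)).imp_right Or.inl
  · exact Or.inr (Or.inr (sq_eq_sq_iff_eq_or_eq_neg.1 (sub_eq_zero.1 h)))

theorem half_one_add_quarticSign_eq_ite [CharZero K] [DecidableEq F] [DecidableEq K]
    (h4 : χ ^ 4 = 1) (hω : ω ^ 2 = -1) (x : F) :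
    (if x = 0 then 0 else (1 + quarticSign χ ω x) / 2) =
      if χ x = 1 ∨ χ x = ω then (1 : K) else 0 := by
  have hω0 : ω ≠ 0 := by
    rintro rfl
    norm_num at hω
  have hne : ω ≠ -1 := by
    rintro rfl
    norm_num at hω
  rcases eq_or_ne x 0 with rfl | hx
  · rw [if_pos rfl, if_neg (by simp [MulChar.map_zero, hω0.symm])]
  have hpow : χ x ^ 4 = 1 := by rw [← map_pow, mulChar_apply_pow_eq_one h4 hx]
  have hinv : ω⁻¹ = -ω := inv_eq_of_mul_eq_one_right (by linear_combination -hω)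
  rw [if_neg hx, quarticSign, MulChar.inv_apply_eq_inv']
  rcases eq_or_eq_of_pow_four_eq_one hω hpow with h | h | h | h
  · rw [if_pos (Or.inl h), h]
    field_simp
    ring
  · rw [if_neg (by rw [h]; exact not_or.2 ⟨by norm_num, hne.symm⟩), h]
    field_simp
    ring
  · rw [if_pos (Or.inr h), h, hinv]
    linear_combination -hω / 2
  · have hneg : ¬(-ω = 1 ∨ -ω = ω) :=
      not_or.2 ⟨fun h' => hne (neg_eq_iff_eq_neg.1 h'), fun h' => hω0 (neg_eq_self.1 h')⟩
    rw [h, if_neg hneg, inv_neg, hinv]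
    linear_combination hω / 2

end QuarticIndicator

section CliqueCount

open DirichletCharacter

theorem factorial_mul_ncard_cliqueSet_peisertLikeGraph {p m : ℕ} [Fact p.Prime] (hp : p % 8 = 1)
    {g : (ZMod (p ^ (m + 1)))ˣ} (hg : ∀ u : (ZMod (p ^ (m + 1)))ˣ, u ∈ Subgroup.zpowers g)
    {K : Type*} [Field K] [CharZero K] {ψ : DirichletCharacter K p} (hψ : orderOf ψ = 4) {ω : K}
    (hω : ω ^ 2 = -1) (hgω : ψ (primePowReduction p m g) = ω) (n : ℕ) :
    (n.factorial * ((peisertLikeGraph g).cliqueSet n).ncard : K) =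
      (p : K) ^ (m * n) * ∑ v : Fin n → ZMod p,
        completeWeight (fun x => if x = 0 then 0 else (1 + quarticSign ψ ω x) / 2) v := by
  classical
  have hdvd : p ∣ p ^ (m + 1) := dvd_pow_self p m.succ_ne_zero
  have h4 : ψ ^ 4 = 1 := by rw [← hψ, pow_orderOf_eq_one]
  have hadj (x y : ZMod (p ^ (m + 1))) : (peisertLikeGraph g).Adj x y ↔
      ψ (primePowReduction p m x - primePowReduction p m y) = 1 ∨
        ψ (primePowReduction p m x - primePowReduction p m y) = ω := by
    have hord : orderOf (changeLevel hdvd ψ) = 4 :=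
      (orderOf_injective _ (changeLevel_injective hdvd) ψ).trans hψ
    rw [peisertLikeGraph_adj hp m.succ_pos g hg, mem_peisertConnectionSet_iff hg hord,
      changeLevel_apply_primePow, changeLevel_apply_primePow, map_sub, hgω]
  have hcomp := sum_pi_comp_primePowReduction (m := m) fun v : Fin n → ZMod p =>
    completeWeight (fun x => if x = 0 then 0 else (1 + quarticSign ψ ω x) / 2) v
  rw [Fintype.card_fin] at hcomp
  rw [← hcomp, ← Nat.cast_mul, ← card_copy_top, card_copy_top_eq_sum]
  simp only [completeWeight, half_one_add_quarticSign_eq_ite h4 hω, hadj, Function.comp_apply]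

theorem sum_completeWeight_half_one_add_quarticSign_complex {F : Type*} [Field F] [Fintype F]
    [DecidableEq F] (hF : Fintype.card F % 8 = 1) {χ : MulChar F ℂ} (hχ : orderOf χ = 4) {ω : ℂ}
    (hω : ω ^ 2 = -1) {t : F} (ht : χ t = ω) :
    ∑ v : Fin 4 → F,
        completeWeight (fun x => if x = 0 then 0 else (1 + quarticSign χ ω x) / 2) v =
      Fintype.card F * (Fintype.card F - 1) / 64 *
        ((Fintype.card F : ℂ) ^ 2 - 20 * Fintype.card F + 81 + 3 * (jacobiSum χ χ).im ^ 2 +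
          (3 * pathSum χ - (triangleSum χ).re) / 2) := by
  have h4 : χ ^ 4 = 1 := by rw [← hχ, pow_orderOf_eq_one]
  have h2 : χ ^ 2 ≠ 1 := pow_ne_one_of_lt_orderOf two_ne_zero (by rw [hχ]; norm_num)
  have hJ : jacobiSum χ χ - jacobiSum χ⁻¹ χ⁻¹ = 2 * (jacobiSum χ χ).im * Complex.I := by
    rw [← conj_jacobiSum, Complex.sub_conj]
    push_cast
    rfl
  have hT : triangleSum χ + triangleSum χ⁻¹ = 2 * (triangleSum χ).re := by
    rw [← conj_triangleSum, Complex.add_conj]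
    push_cast
    rfl
  rw [sum_completeWeight_half_one_add_quarticSign (mulChar_neg_one_eq_one hF h4) h4 h2 hω ht,
    hJ, hT, mul_pow, Complex.I_sq]
  ring

theorem ncard_cliqueSet_four_peisertLikeGraph {p m : ℕ} [Fact p.Prime] (hp : p % 8 = 1)
    {g : (ZMod (p ^ (m + 1)))ˣ} (hg : ∀ u : (ZMod (p ^ (m + 1)))ˣ, u ∈ Subgroup.zpowers g)
    {ψ : DirichletCharacter ℂ p} (hψ : orderOf ψ = 4)
    (hgψ : ψ (primePowReduction p m g) ^ 2 = -1) :
    (((peisertLikeGraph g).cliqueSet 4).ncard : ℂ) =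
      p ^ (4 * m + 1) * (p - 1) / 1536 *
        ((p : ℂ) ^ 2 - 20 * p + 81 + 3 * (jacobiSum ψ ψ).im ^ 2 +
          (3 * pathSum ψ - (triangleSum ψ).re) / 2) := by
  have hfactorial : ((4).factorial : ℂ) = 24 := by norm_num [Nat.factorial]
  have hcount := factorial_mul_ncard_cliqueSet_peisertLikeGraph hp hg hψ hgψ rfl 4
  rw [sum_completeWeight_half_one_add_quarticSign_complex (by rwa [ZMod.card]) hψ hgψ rfl,
    ZMod.card, hfactorial] at hcount
  linear_combination hcount / 24

end CliqueCount

theorem sq_mul_dirichletHypergeometric_eq_triangleSum {q : ℕ} [NeZero q]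
    {χ : DirichletCharacter ℂ q} (h4 : χ ^ 4 = 1) :
    (q : ℂ) ^ 2 * dirichletHypergeometric χ ![χ⁻¹, χ⁻¹] ![χ ^ 2, 1] 1 = triangleSum χ := by
  have hinv : χ * χ ^ 2 = χ⁻¹ := by rw [eq_inv_iff_mul_eq_one, ← h4]; group
  have hcube : χ⁻¹ * (χ ^ 2)⁻¹ = χ := by rw [← mul_inv, hinv, inv_inv]
  rw [sq_mul_dirichletHypergeometric_one, triangleSum, hcube, inv_inv, hinv, inv_mul_cancel,
    inv_one, mul_one, mul_one, MulChar.one_apply isUnit_one.neg, one_mul]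

theorem sq_mul_dirichletHypergeometric_eq_pathSum {q : ℕ} [NeZero q]
    (χ : DirichletCharacter ℂ q) :
    (q : ℂ) ^ 2 * dirichletHypergeometric χ ![χ, χ⁻¹] ![1, 1] 1 = pathSum χ := by
  rw [sq_mul_dirichletHypergeometric_one, pathSum, inv_inv, inv_mul_cancel, inv_one, mul_one,
    mul_one, mul_one, MulChar.one_apply isUnit_one.neg, one_mul]

theorem theorem2 (p α : ℕ) [Fact p.Prime] (hp : p % 8 = 1) (hα : 1 ≤ α)
    (g : (ZMod (p ^ α))ˣ) (hg : ∀ u : (ZMod (p ^ α))ˣ, u ∈ Subgroup.zpowers g)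
    (χ₄ φ : DirichletCharacter ℂ (p ^ α)) (hχ₄ : orderOf χ₄ = 4) (hφ : orderOf φ = 2)
    (ρ ξ M₃ M₅ : ℂ)
    (hρ : ρ = jacobiSum χ₄ χ₄) (hξ : ξ = jacobiSum χ₄ φ)
    (hM₃ : M₃ = ((p ^ α : ℕ) : ℂ) ^ 2 * dirichletHypergeometric χ₄ ![χ₄⁻¹, χ₄⁻¹] ![φ, 1] 1)
    (hM₅ : M₅ = ((p ^ α : ℕ) : ℂ) ^ 2 * dirichletHypergeometric χ₄ ![χ₄, χ₄⁻¹] ![1, 1] 1) :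
    (((peisertLikeGraph g).cliqueSet 4).ncard : ℂ) =
      (p : ℂ) ^ (2 * α - 1) * ((p : ℂ) - 1) / 3072 *
        (2 * (p : ℂ) ^ (2 * α - 2) * ((p : ℂ) ^ 2 - 20 * (p : ℂ) + 81)
          + 2 * (ρ.im : ℂ) ^ 2 + 4 * (ρ.im : ℂ) * (ξ.im : ℂ)
          - (M₃.re : ℂ) + 3 * M₅) := by
  obtain ⟨m, rfl⟩ := Nat.exists_eq_add_of_le' hα
  obtain rfl := eq_of_orderOf_eq_two hg hφ (orderOf_sq_eq_two hχ₄)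
  have hcoprime : (orderOf χ₄).Coprime p := by
    rw [hχ₄]
    exact Nat.Coprime.pow_left 2 (Nat.coprime_two_left.2 (Nat.odd_iff.2 (by omega)))
  obtain ⟨hdvd, ψ, rfl⟩ := factorsThrough_of_coprime_orderOf hcoprime
  have hψ : orderOf ψ = 4 :=
    (orderOf_injective _ (DirichletCharacter.changeLevel_injective hdvd) ψ).symm.trans hχ₄
  have hgψ := apply_generator_eq_neg_one hg hφ
  rw [MulChar.pow_apply_coe, changeLevel_apply_primePow] at hgψ
  rw [jacobiSum_changeLevel_primePow, ← Complex.ofReal_natCast, ← Complex.ofReal_pow] at hρ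
  rw [← map_pow, jacobiSum_changeLevel_primePow, jacobiSum_self_sq (by rwa [ZMod.card]) hψ,
    ← Complex.ofReal_natCast, ← Complex.ofReal_pow] at hξ
  rw [sq_mul_dirichletHypergeometric_eq_triangleSum (by rw [← hχ₄, pow_orderOf_eq_one]),
    triangleSum_changeLevel_primePow, ← Complex.ofReal_natCast, ← Complex.ofReal_pow] at hM₃
  rw [sq_mul_dirichletHypergeometric_eq_pathSum, pathSum_changeLevel_primePow] at hM₅
  rw [ncard_cliqueSet_four_peisertLikeGraph hp hg hψ hgψ, hρ, hξ, hM₃, hM₅,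
    Complex.im_ofReal_mul, Complex.re_ofReal_mul, Nat.mul_add_one, Nat.add_sub_cancel,
    show 2 * m + 2 - 1 = 2 * m + 1 from rfl]
  push_cast
  ring
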